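/- **Setting.** Let $P$ be the law of a random variable $Z$ with values in a measurable space $\mathcal Z$, let $\mathcal W\subseteq\mathbb R^d$ be closed and convex with $\ell_2$-diameter $0<\Delta<\infty$, let $0<\alpha<1/2$ and $0<\delta<1$, and let $\ell(w;z)$ be a loss that is non-negative for $w\in\mathcal W$. For every $z$ let $w\mapsto\ell(w;z)$ be convex and $\lambda_\ell$-Lipschitz on a fixed open convex set containing $\mathcal W$. For $w\in\mathcal W$ let $\mathbb E\,\ell(w;Z)^2<\infty$, let $F_w(u)=P\{\ell(w;Z)\le u\}$ be continuous, and write, for $0<a<1$, $$V_a(w)=\inf\{u: F_w(u)\ge 1-a\},\qquad C_\alpha(w)=\tfrac1\alpha\,\mathbb E\big[\ell(w;Z)\,I_{\{\ell(w;Z)\ge V_\alpha(w)\}}\big],\qquad C_\alpha^*=\inf_{w\in\mathcal W}C_\alpha(w),$$ $$\sigma_\alpha(w)^2=\mathbb E\big[\ell(w;Z)^2I_{\{\ell(w;Z)\ge V_{2\alpha}(w)\}}\big]-\big(\mathbb E\big[\ell(w;Z)I_{\{\ell(w;Z)\ge V_{\alpha/2}(w)\}}\big]\big)^2 .$$ Assume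 that there are $0<\gamma<\lambda<\infty$ with $\gamma|u|\le|F_w(V_\alpha(w)+u)-F_w(V_\alpha(w))|\le\lambda|u|$ for all $w\in\mathcal W$ and $|u|\le1$. Let $\bar V_a=\sup_{w\in\mathcal W}V_a(w)$, $\bar\sigma_\alpha=\sup_{w\in\mathcal W}\sigma_\alpha(w)$ and $\bar r=\sup_{w\in\mathcal W}(\mathbb E\,\ell(w;Z)^2)^{1/2}$, where $\bar V_\alpha,\bar\sigma_\alpha<\infty$. Put $$k_\delta=\lceil\log(1/\delta)\rceil,\quad \delta^*=\frac{\delta}{2k_\delta},\quad k=\lceil\log(2k_\delta/\delta)\rceil=\lceil\log(1/\delta^*)\rceil,\quad L=\log(5/\delta^*),\quad m=\lfloor n/2\rfloor,$$ and assume that $$m\ \ge\ (1+L)\,\max\Big\{\frac1{2\gamma^2},\frac{16}{3\alpha}\Big\}.$$ **Mean estimation sub-routine.** Let $R:\mathbb R^m\to\mathbb R$ be measurable, with a constant $c$ and a scale $s$, of one of the following kinds, for the confidence level $\eta=\delta^*/5$. * (general) $c>0$, $s=\bar\sigma_\alpha$ (or $s=\bar r$), and for every law $\nu$ on $\mathbb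 R$ with finite second moment and standard deviation (respectively, root mean square) at most $s$, an i.i.d. sample $u$ of size $m$ from $\nu$ satisfies $|R(u)-\int x\,d\nu|>cs\sqrt{(1+\log(1/\eta))/m}$ with probability at most $\eta$; * (median of means) $R(u)$ is a median of the means of $u$ over $\lceil\log(1/\eta)\rceil$ disjoint blocks that cover $\{1,\dots,m\}$ and have at least $\lfloor m/\lceil\log(1/\eta)\rceil\rfloor$ elements each; $c=2\sqrt2\,\mathrm e$, $s=\bar\sigma_\alpha$; * (Catoni type) $R(u)$ minimizes $v\mapsto\sum_i\rho((u_i-v)/a)$, where $\rho$ is convex and differentiable, $-\log(1-x+x^2/2)\le\rho'(x)\le\log(1+x+x^2/2)$, $a=\bar\sigma_\alpha/\sqrt{q(1-q)}$, $q=2\log(2/\eta)/m$; $c=2$, $s=\bar\sigma_\alpha$; * (soft truncation) $R(u)=\frac am\sum_i\psi(u_i/a)$, where $\psi$ is non-decreasing, $-\log(1-x+x^2/2)\le\psi(x)\le\log(1+x+x^2/2)$, and $a=\bar r\sqrt{m/(2\log(2/\eta))}$; $c=\sqrt2$, $s=\bar r$. **Algorithm.** Let $Z_1,\dots,Z_n,Z_1',\dots,Z_n'$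 be independent copies of $Z$. Split $\{1,\dots,n\}$ into disjoint $I_1,\dots,I_k$ with $|I_j|\ge\lfloor n/k\rfloor$. Let $f_\alpha(w,v;z)=v+\frac1\alpha[\ell(w;z)-v]_+$ and let $G(w,v;z)$ be a measurable choice of a sub-gradient of $f_\alpha(\cdot,\cdot;z)$ at $(w,v)$. For each $j$, run projected stochastic sub-gradient descent from a fixed point $(w_0,v_0)\in\mathcal W\times[0,\bar V_\alpha]$, using each $Z_i$, $i\in I_j$, once, $$(w_t,v_t)=\mathrm{Proj}_{\mathcal W\times[0,\bar V_\alpha]}\big[(w_{t-1},v_{t-1})-\beta_j\,G(w_{t-1},v_{t-1};Z_{(t)})\big],\qquad \beta_j=\alpha\sqrt{\frac{\Delta^2+\bar V_\alpha^2}{(\lambda_\ell^2+(1-\alpha)^2)\,|I_j|}},$$ where $Z_{(t)}$ is the $t$-th of these observations, and let $\bar w^{(j)}$ be the average of $w_0,\dots,w_{|I_j|-1}$. For $w\in\mathcal W$ let $\hat v$ be the $\lfloor(1-\alpha)(n-m)\rfloor$-th smallest of $\ell(w;Z'_{m+1}),\dots,\ell(w;Z'_n)$, and let $\hat C'(w)=R\big((\ell(w;Z_i')I_{\{\ell(w;Z_i')\ge\hat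 v\}})_{i\le m}\big)$. Return $\bar w^{(\star)}$, where $\star$ minimizes $\hat C'(\bar w^{(j)})$ over $j\in\{1,\dots,k\}$. **Theorem.** With probability at least $1-3\delta$, $\bar w^{(\star)}\in\mathcal W$ and $$C_\alpha(\bar w^{(\star)})-C_\alpha^*\ \le\ \frac2\alpha\Big(c\,s+\frac{\bar V_{\alpha/2}\,\lambda}{\sqrt2\,\gamma}\Big)\sqrt{\frac{1+\log(5/\delta^*)}{\lfloor n/2\rfloor}}+\frac{\mathrm e}{\alpha}\sqrt{\frac{(\lambda_\ell^2+(1-\alpha)^2)(\Delta^2+\bar V_\alpha^2)}{\lfloor n/k\rfloor}} .$$ -/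

import Mathlib

noncomputable section

open MeasureTheory

namespace CVaRLearning

/-! Value-at-risk, conditional value-at-risk and the related constants of a random loss. -/

section Risk

variable {S : Type*} [MeasurableSpace S]

/-- The distribution function `u ↦ P{X ≤ u}` of a random variable `X`. -/
def distFun (P : Measure S) (X : S → ℝ) (u : ℝ) : ℝ :=
  P.real {z | X z ≤ u}

/-- Value-at-risk: the smallest `(1 - α)`-quantile of `X`. -/
def valueAtRisk (P : Measure S) (α : ℝ) (X : S → ℝ) : ℝ :=
  sInf {u : ℝ | 1 - α ≤ distFun P X u}

/-- Conditional value-at-risk: `α⁻¹ 𝔼[X ; X ≥ V_α]`. -/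
def cvar (P : Measure S) (α : ℝ) (X : S → ℝ) : ℝ :=
  1 / α * ∫ z in {z | valueAtRisk P α X ≤ X z}, X z ∂P

/-- `σ_α`, where `σ_α² = 𝔼[X² ; X ≥ V_{2α}] - (𝔼[X ; X ≥ V_{α/2}])²`. -/
def tailStd (P : Measure S) (α : ℝ) (X : S → ℝ) : ℝ :=
  √((∫ z in {z | valueAtRisk P (2 * α) X ≤ X z}, X z ^ 2 ∂P)
    - (∫ z in {z | valueAtRisk P (α / 2) X ≤ X z}, X z ∂P) ^ 2)

/-- Root mean square `(𝔼 X²)^{1/2}`. -/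
def rootMeanSq (P : Measure S) (X : S → ℝ) : ℝ :=
  √(∫ z, X z ^ 2 ∂P)

/-- Local growth and Lipschitz property of the distribution function around the value-at-risk. -/
def LocalGrowth (P : Measure S) (α γ lam : ℝ) (X : S → ℝ) : Prop :=
  ∀ u : ℝ, |u| ≤ 1 →
    γ * |u| ≤ |distFun P X (valueAtRisk P α X + u) - distFun P X (valueAtRisk P α X)| ∧
    |distFun P X (valueAtRisk P α X + u) - distFun P X (valueAtRisk P α X)| ≤ lam * |u|

end Risk

/-! Robust mean estimation. -/

/-- Standard deviation of a law on the line. -/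
def lawStd (ν : Measure ℝ) : ℝ := √(ProbabilityTheory.variance id ν)

/-- Root mean square of a law on the line. -/
def lawRms (ν : Measure ℝ) : ℝ := √(∫ x, x ^ 2 ∂ν)

/-- The sub-Gaussian guarantee of a mean estimator `R` from `m` observations, at confidence
level `η` and with constant `c`, on all square-integrable laws `ν` of scale `τ ν ≤ s`:
for an i.i.d. sample from `ν`, the deviation of `R` from the mean of `ν` exceeds
`c s ((1 + log (1/η)) / m)^{1/2}` with probability at most `η`.  (Estimators whose tuning needs
a bound on the scale of the data may be tuned with `s`.) -/
def MeanGuarantee {m : ℕ} (τ : Measure ℝ → ℝ) (c η s : ℝ) (R : (Fin m → ℝ) → ℝ) : Prop :=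
  ∀ (ν : Measure ℝ) [IsProbabilityMeasure ν], MemLp id 2 ν → τ ν ≤ s →
    (Measure.pi fun _ : Fin m => ν)
      {u | c * s * √((1 + Real.log (1 / η)) / m) < |R u - ∫ x, x ∂ν|} ≤ ENNReal.ofReal η

/-- Arithmetic mean of the observations with index in `B`. -/
def blockMean {m : ℕ} (B : Finset (Fin m)) (u : Fin m → ℝ) : ℝ :=
  (∑ i ∈ B, u i) / B.card

/-- `x` is a median of the finite family `a`. -/
def IsMedian {k : ℕ} (a : Fin k → ℝ) (x : ℝ) : Prop :=
  (k : ℝ) / 2 ≤ (Finset.univ.filter fun j => a j ≤ x).card ∧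
  (k : ℝ) / 2 ≤ (Finset.univ.filter fun j => x ≤ a j).card

/-- `I` is a partition of `{1, …, n}` into `k` disjoint parts with at least `⌊n/k⌋` elements. -/
def IsBalancedPartition {n k : ℕ} (I : Fin k → Finset (Fin n)) : Prop :=
  (∀ i j, i ≠ j → Disjoint (I i) (I j)) ∧ (∀ i, ∃ j, i ∈ I j) ∧ ∀ j, n / k ≤ (I j).card

/-- Median-of-means with `k` blocks. -/
def IsMedianOfMeans {m : ℕ} (k : ℕ) (R : (Fin m → ℝ) → ℝ) : Prop :=
  ∃ B : Fin k → Finset (Fin m), IsBalancedPartition B ∧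
    ∀ u, IsMedian (fun j => blockMean (B j) u) (R u)

/-- Two-sided logarithmic bounds on an influence function. -/
def LogBounds (ψ : ℝ → ℝ) : Prop :=
  ∀ x, -Real.log (1 - x + x ^ 2 / 2) ≤ ψ x ∧ ψ x ≤ Real.log (1 + x + x ^ 2 / 2)

/-- M-estimator with scaling parameter `a`: a minimizer of `v ↦ ∑ ρ((uᵢ - v) / a)`, where `ρ` is
convex and differentiable, and `ρ'` obeys the logarithmic bounds. -/
def IsCatoni {m : ℕ} (a : ℝ) (R : (Fin m → ℝ) → ℝ) : Prop :=
  ∃ ρ : ℝ → ℝ, ConvexOn ℝ Set.univ ρ ∧ Differentiable ℝ ρ ∧ LogBounds (deriv ρ) ∧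
    ∀ u v, ∑ i, ρ ((u i - R u) / a) ≤ ∑ i, ρ ((u i - v) / a)

/-- Soft truncation with scaling parameter `a`: `(a / m) ∑ ψ(uᵢ / a)`. -/
def IsSoftTruncation {m : ℕ} (a : ℝ) (R : (Fin m → ℝ) → ℝ) : Prop :=
  ∃ ψ : ℝ → ℝ, Monotone ψ ∧ LogBounds ψ ∧ ∀ u, R u = a / m * ∑ i, ψ (u i / a)

/-- `RobustMean η σ r R c s`: `R` is a robust mean estimation sub-routine for confidence
level `η`, with constant `c` and scale `s`.  The scale is `σ` for sub-routines whose accuracy is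
governed by the standard deviation of the data and `r` for those governed by the root mean
square of the data. -/
inductive RobustMean {m : ℕ} (η σ r : ℝ) (R : (Fin m → ℝ) → ℝ) : ℝ → ℝ → Prop
  | ofStd {c : ℝ} (hc : 0 < c) (h : MeanGuarantee lawStd c η σ R) : RobustMean η σ r R c σ
  | ofRms {c : ℝ} (hc : 0 < c) (h : MeanGuarantee lawRms c η r R) : RobustMean η σ r R c r
  | medianOfMeans (h : IsMedianOfMeans ⌈Real.log (1 / η)⌉₊ R) :
      RobustMean η σ r R (2 * √2 * Real.exp 1) σ
  | catoni {x : ℝ} (hx : x = 2 * Real.log (2 / η) / m) (h : IsCatoni (σ / √(x * (1 - x))) R) :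
      RobustMean η σ r R 2 σ
  | softTruncation (h : IsSoftTruncation (r * √(m / (2 * Real.log (2 / η)))) R) :
      RobustMean η σ r R (√2) r

/-! Robust estimation of the conditional value-at-risk. -/

/-- The `j`-th smallest of `Y₁, …, Y_l` (`1 ≤ j ≤ l`). -/
def orderStat {l : ℕ} (Y : Fin l → ℝ) (j : ℕ) : ℝ :=
  if h : j - 1 < l then Y (Tuple.sort Y ⟨j - 1, h⟩) else 0

/-- Robust estimate of `α · CVaR_α` from a sample `X` and an ancillary sample `Y`: with the
empirical quantile `v` of `Y`, apply `R` to the values `Xᵢ 𝟙{Xᵢ ≥ v}`. -/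
def scaledCVaREst {m l : ℕ} (R : (Fin m → ℝ) → ℝ) (α : ℝ) (X : Fin m → ℝ) (Y : Fin l → ℝ) : ℝ :=
  R fun i => if orderStat Y ⌊(1 - α) * l⌋₊ ≤ X i then X i else 0

/-- Validation score of a candidate with loss `X : S → ℝ`, from a sample of size `n` that is
split into its first `⌊n/2⌋` elements and the rest. -/
def validate {S : Type*} {n : ℕ} (R : (Fin (n / 2) → ℝ) → ℝ) (α : ℝ) (X : S → ℝ)
    (z : Fin n → S) : ℝ :=
  scaledCVaREst R α
    (fun i : Fin (n / 2) => X (z (Fin.castLE (Nat.div_le_self n 2) i)))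
    (fun i : Fin (n - n / 2) => X (z ⟨n / 2 + i, by omega⟩))

/-! Projected stochastic sub-gradient descent on the joint objective. -/

/-- The parameter space `ℝ^d`. -/
abbrev Par (d : ℕ) := EuclideanSpace ℝ (Fin d)

/-- The space `ℝ^d × ℝ` of pairs `(w, v)` with its Euclidean norm. -/
abbrev Joint (d : ℕ) := WithLp 2 (Par d × ℝ)

section Sgd

variable {S : Type*} {d : ℕ}

/-- The integrand `f_α(w, v; z) = v + α⁻¹ [ℓ(w; z) - v]₊`. -/
def objective (α : ℝ) (loss : Par d → S → ℝ) (z : S) (x : Joint d) : ℝ :=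
  x.snd + 1 / α * max (loss x.fst z - x.snd) 0

/-- The feasible set `W × [0, V]`. -/
def feasible (W : Set (Par d)) (V : ℝ) : Set (Joint d) :=
  {x | x.fst ∈ W ∧ x.snd ∈ Set.Icc 0 V}

/-- `g` is a sub-gradient at `x` of the function `f` with domain `D`. -/
def IsSubgradient (D : Set (Joint d)) (f : Joint d → ℝ) (x g : Joint d) : Prop :=
  ∀ y ∈ D, f x + inner ℝ g (y - x) ≤ f y

/-- Euclidean projection on `K` (the unique closest point if `K` is closed, convex, nonempty). -/
def proj (K : Set (Joint d)) (x : Joint d) : Joint d :=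
  Classical.epsilon fun y => y ∈ K ∧ ∀ y' ∈ K, ‖x - y‖ ≤ ‖x - y'‖

/-- Iterates of projected stochastic sub-gradient descent with constant step size `β`, update
direction `G`, initial value `x₀`, and data `z₁, …, z_m` (used once each, in order). -/
def sgd (K : Set (Joint d)) (G : Joint d → S → Joint d) (β : ℝ) (x₀ : Joint d)
    {m : ℕ} (z : Fin m → S) : ℕ → Joint d
  | 0 => x₀
  | t + 1 =>
    if h : t < m then
      proj K (sgd K G β x₀ z t - β • G (sgd K G β x₀ z t) (z ⟨t, h⟩))
    else sgd K G β x₀ z t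

/-- The average of the iterates with index `0, …, m - 1`. -/
def sgdAverage (K : Set (Joint d)) (G : Joint d → S → Joint d) (β : ℝ) (x₀ : Joint d)
    {m : ℕ} (z : Fin m → S) : Joint d :=
  (1 / (m : ℝ)) • ∑ t ∈ Finset.range m, sgd K G β x₀ z t

/-- The candidate parameter of the sub-process that uses the observations with index in `I`. -/
def candidate (K : Set (Joint d)) (G : Joint d → S → Joint d) (β : ℝ) (x₀ : Joint d)
    {n : ℕ} (I : Finset (Fin n)) (z : Fin n → S) : Par d :=
  (sgdAverage K G β x₀ fun t : Fin I.card => z (I.orderEmbOfFin rfl t)).fst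

/-- `w` is an output of the learning algorithm on the training sample `z` and the validation
sample `z'`: a candidate with the smallest validation score.  The `j`-th sub-process uses the
observations with index in `I j` and step size `β j`. -/
def IsOutput {n k : ℕ} (R : (Fin (n / 2) → ℝ) → ℝ) (α : ℝ) (loss : Par d → S → ℝ)
    (K : Set (Joint d)) (G : Joint d → S → Joint d) (x₀ : Joint d)
    (I : Fin k → Finset (Fin n)) (β : Fin k → ℝ) (z z' : Fin n → S) (w : Par d) : Prop :=
  ∃ j : Fin k, w = candidate K G (β j) x₀ (I j) z ∧
    ∀ i : Fin k, validate R α (loss w) z' ≤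
      validate R α (loss (candidate K G (β i) x₀ (I i) z)) z'

end Sgd

/-! Constants. -/

/-- The confidence level `δ* = δ / (2 ⌈log (1/δ)⌉)` of a single sub-process. -/
def subLevel (δ : ℝ) : ℝ := δ / (2 * ⌈Real.log (1 / δ)⌉₊)

/-- The number `k = ⌈log (2 ⌈log (1/δ)⌉ / δ)⌉` of sub-processes. -/
def numParts (δ : ℝ) : ℕ := ⌈Real.log (2 * ⌈Real.log (1 / δ)⌉₊ / δ)⌉₊

/-- Supremum over `w ∈ W` of a functional of the loss of `w`. -/
def supOver {S : Type*} {d : ℕ} (W : Set (Par d)) (loss : Par d → S → ℝ) (Φ : (S → ℝ) → ℝ) : ℝ :=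
  sSup ((fun w => Φ (loss w)) '' W)

/-- Infimum over `w ∈ W` of a functional of the loss of `w`. -/
def infOver {S : Type*} {d : ℕ} (W : Set (Par d)) (loss : Par d → S → ℝ) (Φ : (S → ℝ) → ℝ) : ℝ :=
  sInf ((fun w => Φ (loss w)) '' W)

end CVaRLearning

end

open MeasureTheory CVaRLearning

/-!
The argument separates the training sample, which produces the candidates, from the validation
sample, which selects one of them.

*Candidates.*  By the Rockafellar–Uryasev identity, `C_α(w)` is the minimum over `v` of the expected
objective `𝔼 f_α(w, v; Z)`, attained at `v = V_α(w)` (`cvar_le_expObjective`).  Sub-gradients of the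
objective have norm at most `√(λ_ℓ² + (1 - α)²) / α` (`IsSubgradient.norm_le`), so averaged projected
sub-gradient descent with the given step size has expected excess at most
`α⁻¹ √((λ_ℓ² + (1 - α)²) (Δ² + V̄²) / |I_j|)` (`integral_sgdAverage_sub_le`).  By Markov's inequality a
candidate exceeds `e` times this bound with probability at most `1/e`
(`pi_excess_sgdAverage_le`); the blocks are disjoint, so all `k` candidates do so with probability
at most `e⁻ᵏ ≤ δ*`.

*Validation.*  For a fixed `w` the score `Ĉ'(w)` estimates `α C_α(w)`, the mean of the loss above
`V_α(w)`.  By the inequalities of Hoeffding and Chernoff, the empirical quantile `v̂` is, up to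
probability `4 δ*/5`, within `(2 γ²)^{-1/2} ((1 + L)/m)^{1/2}` of `V_α(w)` and between `V_{2α}(w)` and
`V_{α/2}(w)` (`pi_empQuantile_deviation_le`).  Replacing `V_α(w)` by `v̂` then moves the tail mean by at
most `V_{α/2}(w) λ |v̂ - V_α(w)|`, and the loss truncated at `v̂` has standard deviation at most
`σ_α(w)`.  Given `v̂`, the mean estimator is applied to an independent i.i.d. sample, and errs by more
than `c s ((1 + L)/m)^{1/2}` with probability at most `δ*/5`.  Together this is
`pi_lt_abs_validate_sub_le`.  That the median of means, Catoni's estimator and soft truncation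
satisfy the general guarantee is `RobustMean.meanGuarantee`; it needs a positive scale, which is
what `tailStd_pos` provides.

*Conclusion.*  The validation sample is independent of the candidates, so all `k` scores are accurate
up to probability `k δ* ≤ δ`.  Then the selected candidate is worse than the best one by at most
twice the validation error.  The total failure probability obtained is `2 δ`.
-/

namespace CVaRLearning

open MeasureTheory ProbabilityTheory

/-! ### Product measures: resampling, independence, exponential moments -/

section Product

variable {S : Type*} [MeasurableSpace S] (P : Measure S) [IsProbabilityMeasure P]
variable {ι : Type*} [Fintype ι]

/-- Replacing the coordinates outside `s` of an i.i.d. sample by those of an independent copy does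
not change its law.  Independence of functions of disjoint groups of coordinates, in all the forms
used below, comes from this. -/
theorem measurePreserving_piecewise (s : Set ι) [∀ i, Decidable (i ∈ s)] :
    MeasurePreserving (fun p : (ι → S) × (ι → S) => s.piecewise p.1 p.2)
      ((Measure.pi fun _ => P).prod (Measure.pi fun _ => P)) (Measure.pi fun _ => P) := by
  have hm : Measurable (fun p : (ι → S) × (ι → S) => s.piecewise p.1 p.2) := by
    refine measurable_pi_lambda _ fun i => ?_
    by_cases hi : i ∈ s
    · simpa only [Set.piecewise, hi, if_true] using (by fun_prop)
    · simpa only [Set.piecewise, hi, if_false] using (by fun_prop)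
  refine ⟨hm, (Measure.pi_eq fun A hA => ?_).symm⟩
  rw [Measure.map_apply hm (MeasurableSet.univ_pi hA)]
  have : (fun p : (ι → S) × (ι → S) => s.piecewise p.1 p.2) ⁻¹' (Set.univ.pi A) =
      (Set.univ.pi fun i => if i ∈ s then A i else Set.univ) ×ˢ
        (Set.univ.pi fun i => if i ∈ s then Set.univ else A i) := by
    ext p
    simp only [Set.mem_preimage, Set.mem_pi, Set.mem_univ, forall_const, Set.mem_prod,
      ← forall_and]
    refine forall_congr' fun i => ?_
    by_cases hi : i ∈ s <;> simp [hi]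
  rw [this, Measure.prod_prod, Measure.pi_pi, Measure.pi_pi, ← Finset.prod_mul_distrib]
  refine Finset.prod_congr rfl fun i _ => ?_
  by_cases hi : i ∈ s <;> simp [hi]

/-- A subsample of an i.i.d. sample, selected by an injection, is i.i.d. -/
theorem measurePreserving_comp_injective {κ : Type*} [Fintype κ] {e : κ → ι}
    (he : Function.Injective e) :
    MeasurePreserving (fun z : ι → S => z ∘ e) (Measure.pi fun _ => P)
      (Measure.pi fun _ => P) := by
  have hm : Measurable (fun z : ι → S => z ∘ e) :=
    measurable_pi_lambda _ fun i => measurable_pi_apply (e i)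
  refine ⟨hm, ?_⟩
  have h := (iIndepFun_pi (μ := fun _ : ι => P) (X := fun _ => id)
    fun _ => aemeasurable_id).precomp he
  have h2 := h.map_fun_eq_pi_map fun i => (measurable_pi_apply (e i)).aemeasurable
  refine h2.trans ?_
  congr 1
  funext i
  exact (measurePreserving_eval (fun _ : ι => P) (e i)).map_eq

/-- Events that depend on disjoint groups of coordinates multiply. -/
theorem pi_inter_eq_mul {A B : Set (ι → S)} (hA : MeasurableSet A) (hB : MeasurableSet B)
    (s : Set ι) (hAs : DependsOn (· ∈ A) s) (hBs : DependsOn (· ∈ B) sᶜ) :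
    (Measure.pi fun _ => P) (A ∩ B) =
      (Measure.pi fun _ => P) A * (Measure.pi fun _ => P) B := by
  classical
  rw [← (measurePreserving_piecewise P s).measure_preimage (hA.inter hB).nullMeasurableSet,
    ← Measure.prod_prod]
  congr 1
  ext p
  have h1 : s.piecewise p.1 p.2 ∈ A ↔ p.1 ∈ A :=
    iff_of_eq (hAs fun i hi => by simp [hi])
  have h2 : s.piecewise p.1 p.2 ∈ B ↔ p.2 ∈ B :=
    iff_of_eq (hBs fun i hi => by simp only [Set.mem_compl_iff] at hi; simp [hi])
  simp [h1, h2]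

theorem pi_biInter_eq_prod {κ : Type*} (I : κ → Finset ι)
    (hI : ∀ i j, i ≠ j → Disjoint (I i) (I j)) {A : κ → Set (ι → S)}
    (hA : ∀ j, MeasurableSet (A j)) (hAI : ∀ j, DependsOn (· ∈ A j) (I j : Set ι))
    (T : Finset κ) :
    (Measure.pi fun _ => P) (⋂ j ∈ T, A j) = ∏ j ∈ T, (Measure.pi fun _ => P) (A j) := by
  classical
  induction T using Finset.induction_on with
  | empty => simp
  | insert j T hj ih =>
    rw [Finset.set_biInter_insert, Finset.prod_insert hj, ← ih]
    refine pi_inter_eq_mul P (hA j) (Finset.measurableSet_biInter T fun i _ => hA i) _ (hAI j) ?_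
    intro x y hxy
    simp only [Set.mem_iInter]
    refine propext (forall₂_congr fun i hi => iff_of_eq (hAI i fun l hl => hxy l ?_))
    have hij : i ≠ j := fun h => hj (h ▸ hi)
    exact fun h => Finset.disjoint_left.1 (hI i j hij) hl h

/-- Integrating out one observation: `x` does not depend on the coordinate `t`. -/
theorem integral_pi_eval {E : Type*} [MeasurableSpace E] (t : ι) {x : (ι → S) → E}
    (hx : Measurable x) (hxt : DependsOn x {t}ᶜ) {h : E → S → ℝ}
    (hh : Measurable fun p : E × S => h p.1 p.2) {C : ℝ} (hC : ∀ z s, |h (x z) s| ≤ C) :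
    ∫ z, h (x z) (z t) ∂(Measure.pi fun _ => P) =
      ∫ z, ∫ s, h (x z) s ∂P ∂(Measure.pi fun _ => P) := by
  classical
  have hmp := measurePreserving_piecewise P ({t}ᶜ : Set ι)
  have hmeas : Measurable fun z : ι → S => h (x z) (z t) :=
    hh.comp (hx.prodMk (measurable_pi_apply t))
  have hmeas2 : Measurable fun p : (ι → S) × (ι → S) => h (x p.1) (p.2 t) :=
    hh.comp ((hx.comp measurable_fst).prodMk ((measurable_pi_apply t).comp measurable_snd))
  rw [← hmp.map_eq, integral_map hmp.measurable.aemeasurable hmeas.aestronglyMeasurable,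
    hmp.map_eq]
  have h1 : ∀ p : (ι → S) × (ι → S),
      h (x (({t}ᶜ : Set ι).piecewise p.1 p.2)) (({t}ᶜ : Set ι).piecewise p.1 p.2 t) =
        h (x p.1) (p.2 t) := by
    intro p
    have : x (({t}ᶜ : Set ι).piecewise p.1 p.2) = x p.1 := hxt fun i hi => by
      simp only [Set.piecewise, hi, if_true]
    rw [this, Set.piecewise_eq_of_notMem _ _ _ (by simp)]
  simp_rw [h1]
  rw [integral_prod _ (Integrable.of_bound hmeas2.aestronglyMeasurable C
    (Filter.Eventually.of_forall fun p => hC p.1 (p.2 t)))]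
  refine integral_congr_ae (Filter.Eventually.of_forall fun z => ?_)
  have he := measurePreserving_eval (fun _ : ι => P) t
  have hz : Measurable fun s => h (x z) s := hh.comp measurable_prodMk_left
  have hint := integral_map (μ := Measure.pi fun _ : ι => P) he.measurable.aemeasurable
    hz.aestronglyMeasurable
  rw [he.map_eq] at hint
  exact hint.symm

/-- Chernoff's bound for a sum over an i.i.d. sample. -/
theorem pi_le_sum_le_exp {g : S → ℝ} (hg : Measurable g) {b t : ℝ}
    (hb : ∫⁻ z, ENNReal.ofReal (Real.exp (g z)) ∂P ≤ ENNReal.ofReal (Real.exp b)) :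
    (Measure.pi fun _ : ι => P) {z | t ≤ ∑ i, g (z i)} ≤
      ENNReal.ofReal (Real.exp (Fintype.card ι * b - t)) := by
  have hm : Measurable fun z => ENNReal.ofReal (Real.exp (g z)) :=
    (Real.measurable_exp.comp hg).ennreal_ofReal
  have hind : iIndepFun (fun (i : ι) (z : ι → S) => ENNReal.ofReal (Real.exp (g (z i))))
      (Measure.pi fun _ => P) :=
    iIndepFun_pi (μ := fun _ : ι => P) fun _ => hm.aemeasurable
  have hprod := lintegral_prod_eq_prod_lintegral_of_indepFun Finset.univ _ hind
    fun i => hm.comp (measurable_pi_apply i)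
  have hone : ∀ i : ι, ∫⁻ z : ι → S, ENNReal.ofReal (Real.exp (g (z i))) ∂(Measure.pi fun _ => P)
      = ∫⁻ s, ENNReal.ofReal (Real.exp (g s)) ∂P := fun i =>
    (measurePreserving_eval (fun _ : ι => P) i).lintegral_comp hm
  simp_rw [hone, Finset.prod_const, Finset.card_univ,
    ← ENNReal.ofReal_prod_of_nonneg fun i _ => (Real.exp_pos _).le, ← Real.exp_sum] at hprod
  have hsub : {z : ι → S | t ≤ ∑ i, g (z i)} ⊆
      {z | ENNReal.ofReal (Real.exp t) ≤ ENNReal.ofReal (Real.exp (∑ i, g (z i)))} :=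
    fun z hz => ENNReal.ofReal_le_ofReal (Real.exp_le_exp.2 hz)
  refine (measure_mono hsub).trans ?_
  refine (meas_ge_le_lintegral_div ?_ ?_ ENNReal.ofReal_ne_top).trans ?_
  · exact (Real.measurable_exp.comp (Finset.measurable_sum _ fun i _ =>
      hg.comp (measurable_pi_apply i))).ennreal_ofReal.aemeasurable
  · simpa using Real.exp_pos t
  rw [hprod, Real.exp_sub, ENNReal.ofReal_div_of_pos (Real.exp_pos t), Real.exp_nat_mul,
    ENNReal.ofReal_pow (Real.exp_pos b).le]
  gcongr

end Product

/-! ### Robust mean estimation -/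

section Mean

variable {m : ℕ} (ν : Measure ℝ) [IsProbabilityMeasure ν]

/-- Chebyshev's inequality for the mean of a block of an i.i.d. sample. -/
theorem pi_le_abs_blockMean_sub_le (hν : MemLp id 2 ν) {B : Finset (Fin m)} (hB : 0 < B.card)
    {t : ℝ} (ht : 0 < t) :
    (Measure.pi fun _ : Fin m => ν) {u | t ≤ |blockMean B u - ∫ x, x ∂ν|} ≤
      ENNReal.ofReal (Var[id; ν] / (B.card * t ^ 2)) := by
  have he := fun i : Fin m => measurePreserving_eval (fun _ : Fin m => ν) i
  have hLp : ∀ i : Fin m, MemLp (fun u : Fin m → ℝ => u i) 2 (Measure.pi fun _ => ν) := fun i =>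
    hν.comp_measurePreserving (he i)
  have hB' : (B.card : ℝ) ≠ 0 := by exact_mod_cast hB.ne'
  have hmeanone : ∀ i : Fin m, ∫ u : Fin m → ℝ, u i ∂(Measure.pi fun _ => ν) = ∫ x, x ∂ν := by
    intro i
    have h := integral_map (μ := Measure.pi fun _ : Fin m => ν) (he i).measurable.aemeasurable
      (f := fun x : ℝ => x) measurable_id.aestronglyMeasurable
    rw [(he i).map_eq] at h
    exact h.symm
  have hmean : ∫ u, blockMean B u ∂(Measure.pi fun _ => ν) = ∫ x, x ∂ν := by
    unfold blockMean
    rw [integral_div, integral_finsetSum _ fun i _ => (hLp i).integrable (by norm_num)]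
    simp_rw [hmeanone]
    rw [Finset.sum_const, nsmul_eq_mul]
    field_simp
  have hbm : blockMean B = fun u => (B.card : ℝ)⁻¹ * (∑ i ∈ B, fun u : Fin m → ℝ => u i) u := by
    funext u
    simp [blockMean, div_eq_inv_mul]
  have hvarone : ∀ i : Fin m, Var[fun u : Fin m → ℝ => u i; Measure.pi fun _ => ν] =
      Var[id; ν] := by
    intro i
    have h := variance_map (μ := Measure.pi fun _ : Fin m => ν) (X := id) (Y := Function.eval i)
      measurable_id.aemeasurable (he i).measurable.aemeasurable
    rw [(he i).map_eq] at h
    exact h.symm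
  have hvar : Var[blockMean B; Measure.pi fun _ => ν] = Var[id; ν] / B.card := by
    rw [hbm, variance_const_mul, IndepFun.variance_sum]
    · simp_rw [hvarone]
      rw [Finset.sum_const, nsmul_eq_mul]
      field_simp
    · exact fun i _ => hLp i
    · intro i _ j _ hij
      exact (iIndepFun_pi (μ := fun _ : Fin m => ν) (X := fun _ => id)
        fun _ => aemeasurable_id).indepFun hij
  have hL : MemLp (blockMean B) 2 (Measure.pi fun _ => ν) := by
    rw [hbm]
    exact (memLp_finsetSum' B fun i _ => hLp i).const_mul _
  have h := meas_ge_le_variance_div_sq hL ht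
  rw [hmean, hvar, div_div] at h
  exact h

/-- If the median of a family is far from `x`, so are at least half of its members. -/
theorem IsMedian.exists_subset {k : ℕ} {a : Fin k → ℝ} {x y t : ℝ} (h : IsMedian a x)
    (ht : t < |x - y|) :
    ∃ T : Finset (Fin k), (k : ℝ) / 2 ≤ T.card ∧ ∀ j ∈ T, t < |a j - y| := by
  rcases lt_abs.1 ht with h1 | h1
  · refine ⟨_, h.2, fun j hj => lt_abs.2 (Or.inl ?_)⟩
    have := (Finset.mem_filter.1 hj).2
    linarith
  · refine ⟨_, h.1, fun j hj => lt_abs.2 (Or.inr ?_)⟩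
    have := (Finset.mem_filter.1 hj).2
    linarith

/-- If every block is inaccurate with probability at most `e⁻² / 4`, then a given half of the
`k` blocks is with probability at most `(2e)⁻ᵏ`, and there are at most `2ᵏ` choices of it. -/
theorem IsMedianOfMeans.pi_lt_abs_sub_le {k : ℕ} {R : (Fin m → ℝ) → ℝ} {B : Fin k → Finset (Fin m)}
    (hB : IsBalancedPartition B) (hR : ∀ u, IsMedian (fun j => blockMean (B j) u) (R u))
    {y t : ℝ} (hp : ∀ j, (Measure.pi fun _ : Fin m => ν) {u | t < |blockMean (B j) u - y|} ≤
      ENNReal.ofReal (Real.exp (-2) / 4)) :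
    (Measure.pi fun _ : Fin m => ν) {u | t < |R u - y|} ≤ ENNReal.ofReal (Real.exp (-k)) := by
  classical
  set A : Fin k → Set (Fin m → ℝ) := fun j => {u | t < |blockMean (B j) u - y|} with hA
  have hAm : ∀ j, MeasurableSet (A j) := fun j => by
    refine measurableSet_lt measurable_const ?_
    unfold blockMean
    fun_prop
  have hAd : ∀ j, DependsOn (· ∈ A j) (B j : Set (Fin m)) := by
    intro j u u' huu
    have : blockMean (B j) u = blockMean (B j) u' := by
      unfold blockMean
      rw [Finset.sum_congr rfl fun i hi => huu i hi]
    simp [hA, this]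
  set 𝒯 := (Finset.univ : Finset (Finset (Fin k))).filter fun T => (k : ℝ) / 2 ≤ T.card with h𝒯
  have hsub : {u | t < |R u - y|} ⊆ ⋃ T ∈ 𝒯, ⋂ j ∈ T, A j := by
    intro u hu
    obtain ⟨T, hT, hTA⟩ := (hR u).exists_subset hu
    simp only [Set.mem_iUnion, Set.mem_iInter]
    exact ⟨T, by simp [h𝒯, hT], hTA⟩
  have h4 : Real.exp (-2) / 4 = Real.exp (-2 - 2 * Real.log 2) := by
    rw [Real.exp_sub, two_mul (Real.log 2), Real.exp_add, Real.exp_log two_pos]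
    norm_num
  have hT : ∀ T ∈ 𝒯, (Measure.pi fun _ : Fin m => ν) (⋂ j ∈ T, A j) ≤
      ENNReal.ofReal (Real.exp (-k - k * Real.log 2)) := by
    intro T hT
    rw [pi_biInter_eq_prod ν B hB.1 hAm hAd]
    refine (Finset.prod_le_prod' fun j _ => hp j).trans ?_
    rw [Finset.prod_const, ← ENNReal.ofReal_pow (by positivity), h4, ← Real.exp_nat_mul]
    refine ENNReal.ofReal_le_ofReal (Real.exp_le_exp.2 ?_)
    have hc := (Finset.mem_filter.1 hT).2
    have hl := Real.log_pos (one_lt_two)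
    nlinarith
  calc (Measure.pi fun _ : Fin m => ν) {u | t < |R u - y|}
      ≤ ∑ T ∈ 𝒯, (Measure.pi fun _ : Fin m => ν) (⋂ j ∈ T, A j) :=
        (measure_mono hsub).trans (measure_biUnion_finset_le _ _)
    _ ≤ ∑ T ∈ 𝒯, ENNReal.ofReal (Real.exp (-k - k * Real.log 2)) := Finset.sum_le_sum hT
    _ ≤ (2 ^ k : ℕ) * ENNReal.ofReal (Real.exp (-k - k * Real.log 2)) := by
        rw [Finset.sum_const, nsmul_eq_mul]
        gcongr
        exact (Finset.card_filter_le _ _).trans (by simp)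
    _ = ENNReal.ofReal (Real.exp (-k)) := by
        rw [← ENNReal.ofReal_natCast, ← ENNReal.ofReal_mul (by positivity), Real.exp_sub,
          Real.exp_nat_mul, Real.exp_log two_pos]
        push_cast
        congr 1
        field_simp

/-- The exponential moment behind Catoni's estimators. -/
theorem lintegral_exp_le_of_le_log (hν : MemLp id 2 ν) {ψ : ℝ → ℝ}
    (hψ : ∀ x, ψ x ≤ Real.log (1 + x + x ^ 2 / 2)) (v a : ℝ) :
    ∫⁻ x, ENNReal.ofReal (Real.exp (ψ ((x - v) / a))) ∂ν ≤
      ENNReal.ofReal (Real.exp ((∫ x, x ∂ν - v) / a + (∫ x, (x - v) ^ 2 ∂ν) / (2 * a ^ 2))) := by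
  have hpos : ∀ x : ℝ, 0 < 1 + x + x ^ 2 / 2 := fun x => by nlinarith [sq_nonneg (x + 1)]
  have hi1 : Integrable (fun x : ℝ => x) ν := hν.integrable (by norm_num)
  have hLv : MemLp (fun x : ℝ => x - v) 2 ν := hν.sub (memLp_const v)
  have hi2 : Integrable (fun x : ℝ => (x - v) ^ 2) ν := hLv.integrable_sq
  have hi3 : Integrable (fun x : ℝ => (x - v) / a) ν := (hi1.sub (integrable_const v)).div_const a
  have hi4 : Integrable (fun x : ℝ => (x - v) ^ 2 / (2 * a ^ 2)) ν := hi2.div_const _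
  have hi5 : Integrable (fun x : ℝ => 1 + (x - v) / a) ν := (integrable_const 1).add hi3
  have hi : Integrable (fun x : ℝ => 1 + (x - v) / a + (x - v) ^ 2 / (2 * a ^ 2)) ν :=
    hi5.add hi4
  have heq : ∀ x : ℝ, 1 + (x - v) / a + ((x - v) / a) ^ 2 / 2 =
      1 + (x - v) / a + (x - v) ^ 2 / (2 * a ^ 2) := fun x => by
    rw [div_pow, div_div, mul_comm (a ^ 2)]
  calc ∫⁻ x, ENNReal.ofReal (Real.exp (ψ ((x - v) / a))) ∂ν
      ≤ ∫⁻ x, ENNReal.ofReal (1 + (x - v) / a + (x - v) ^ 2 / (2 * a ^ 2)) ∂ν := by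
        refine lintegral_mono fun x => ENNReal.ofReal_le_ofReal ?_
        rw [← heq, ← Real.exp_log (hpos ((x - v) / a))]
        exact Real.exp_le_exp.2 (hψ _)
    _ = ENNReal.ofReal (∫ x, (1 + (x - v) / a + (x - v) ^ 2 / (2 * a ^ 2)) ∂ν) := by
        refine (ofReal_integral_eq_lintegral_ofReal hi
          (Filter.Eventually.of_forall fun x => ?_)).symm
        simp only [Pi.zero_apply]
        rw [← heq]
        exact (hpos _).le
    _ ≤ _ := by
        refine ENNReal.ofReal_le_ofReal ?_
        rw [integral_add hi5 hi4, integral_add (integrable_const 1) hi3,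
          integral_div, integral_div, integral_sub hi1 (integrable_const v)]
        simp only [integral_const, probReal_univ, smul_eq_mul, mul_one, one_mul]
        linarith [Real.add_one_le_exp ((∫ x, x ∂ν - v) / a +
          (∫ x, (x - v) ^ 2 ∂ν) / (2 * a ^ 2))]

theorem LogBounds.neg_comp_neg {ψ : ℝ → ℝ} (h : LogBounds ψ) : LogBounds fun x => -ψ (-x) := by
  intro x
  have := h (-x)
  rw [neg_sq, sub_neg_eq_add, ← sub_eq_add_neg] at this
  exact ⟨neg_le_neg this.2, by linarith [this.1]⟩

theorem pi_le_sum_logBounds_le (hν : MemLp id 2 ν) {ψ : ℝ → ℝ} (hm : Measurable ψ)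
    (hψ : ∀ x, ψ x ≤ Real.log (1 + x + x ^ 2 / 2)) {v a t l : ℝ}
    (h : m * ((∫ x, x ∂ν - v) / a + (∫ x, (x - v) ^ 2 ∂ν) / (2 * a ^ 2)) + l ≤ t) :
    (Measure.pi fun _ : Fin m => ν) {u | t ≤ ∑ i, ψ ((u i - v) / a)} ≤
      ENNReal.ofReal (Real.exp (-l)) := by
  refine (pi_le_sum_le_exp ν (ι := Fin m) (g := fun x => ψ ((x - v) / a)) (by fun_prop)
    (lintegral_exp_le_of_le_log ν hν hψ v a)).trans ?_
  refine ENNReal.ofReal_le_ofReal (Real.exp_le_exp.2 ?_)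
  rw [Fintype.card_fin]
  linarith

/-- First-order condition and monotonicity of `ρ'`: the estimate is at least `v` only if the
derivative of the empirical criterion at `v` is not positive, and symmetrically. -/
theorem sum_deriv_of_isMin {ρ : ℝ → ℝ} (hρ : ConvexOn ℝ Set.univ ρ) (hd : Differentiable ℝ ρ)
    {a : ℝ} (ha : 0 < a) {u : Fin m → ℝ} {r : ℝ}
    (hr : ∀ v, ∑ i, ρ ((u i - r) / a) ≤ ∑ i, ρ ((u i - v) / a)) (v : ℝ) :
    (v ≤ r → 0 ≤ ∑ i, deriv ρ ((u i - v) / a)) ∧ (r ≤ v → ∑ i, deriv ρ ((u i - v) / a) ≤ 0) := by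
  have hmono : Monotone (deriv ρ) := by
    have := hρ.monotoneOn_deriv fun x _ => hd x
    rwa [monotoneOn_univ] at this
  have hder : HasDerivAt (fun v => ∑ i, ρ ((u i - v) / a))
      (∑ i, deriv ρ ((u i - r) / a) * (-1 / a)) r := by
    refine HasDerivAt.fun_sum fun i _ => ?_
    exact (hd _).hasDerivAt.comp r (((hasDerivAt_id r).const_sub (u i)).div_const a)
  have h0 := (IsMinOn.isLocalMin (s := Set.univ) (f := fun v => ∑ i, ρ ((u i - v) / a)) (a := r)
    (fun v _ => hr v) Filter.univ_mem).hasDerivAt_eq_zero hder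
  rw [← Finset.sum_mul, mul_eq_zero] at h0
  have h0' : ∑ i, deriv ρ ((u i - r) / a) = 0 := by
    refine h0.resolve_right ?_
    have : -1 / a < 0 := div_neg_of_neg_of_pos (by norm_num) ha
    exact this.ne
  constructor
  · intro hv
    rw [← h0']
    exact Finset.sum_le_sum fun i _ => hmono (by gcongr)
  · intro hv
    rw [← h0']
    exact Finset.sum_le_sum fun i _ => hmono (by gcongr)

theorem integral_sub_sq (hν : MemLp id 2 ν) (v : ℝ) :
    ∫ x, (x - v) ^ 2 ∂ν = Var[id; ν] + (∫ x, x ∂ν - v) ^ 2 := by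
  have h := variance_eq_sub (hν.sub (memLp_const v))
  have h2 : Var[(id : ℝ → ℝ) - (fun _ => v); ν] = Var[id; ν] := by
    exact variance_sub_const hν.aestronglyMeasurable v
  have hi1 : Integrable (fun x : ℝ => x) ν := hν.integrable (by norm_num)
  have h3 : ∫ x, (id x - v) ∂ν = ∫ x, x ∂ν - v := by
    simp only [id]
    rw [integral_sub hi1 (integrable_const v)]
    simp
  rw [h2] at h
  simp only [Pi.pow_apply, Pi.sub_apply] at h
  rw [h3] at h
  simp only [id] at h
  linarith

/-- Union bound for a two-sided deviation. -/
theorem measure_lt_abs_le {Ω : Type*} [MeasurableSpace Ω] (μ : Measure Ω) (f : Ω → ℝ) {t η : ℝ}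
    (h1 : μ {u | t ≤ f u} ≤ ENNReal.ofReal (η / 2))
    (h2 : μ {u | f u ≤ -t} ≤ ENNReal.ofReal (η / 2)) {t' : ℝ} (ht : t ≤ t') (hη : 0 < η) :
    μ {u | t' < |f u|} ≤ ENNReal.ofReal η := by
  have hsub : {u | t' < |f u|} ⊆ {u | t ≤ f u} ∪ {u | f u ≤ -t} := by
    intro u hu
    rcases lt_abs.1 (ht.trans_lt hu) with h | h
    · exact Or.inl h.le
    · exact Or.inr (by simp only [Set.mem_ofPred_eq]; linarith)
  refine (measure_mono hsub).trans ((measure_union_le _ _).trans ?_)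
  refine (add_le_add h1 h2).trans ?_
  rw [← ENNReal.ofReal_add (by linarith) (by linarith), add_halves]

end Mean

section Guarantee

variable {m : ℕ} {η s : ℝ} {R : (Fin m → ℝ) → ℝ}

/-- With `k = ⌈log (1/η)⌉` blocks of at least `m / (2 k)` observations, the constant `2 √2 e` makes
the bound of Chebyshev's inequality for one block equal to `e⁻² / 4`. -/
theorem IsMedianOfMeans.meanGuarantee (hη : 0 < η) (hη1 : η < 1) (hs : 0 < s)
    (hm : 4 * (1 + Real.log (1 / η)) ≤ m) (h : IsMedianOfMeans ⌈Real.log (1 / η)⌉₊ R) :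
    MeanGuarantee lawStd (2 * √2 * Real.exp 1) η s R := by
  intro ν _ hν hτ
  have hexp : Real.exp (-Real.log (1 / η)) = η := by
    rw [one_div, Real.log_inv, neg_neg, Real.exp_log hη]
  set L := Real.log (1 / η) with hL
  have hLpos : 0 < L := Real.log_pos (by rw [one_div]; exact (one_lt_inv₀ hη).2 hη1)
  set k := ⌈L⌉₊ with hk
  obtain ⟨B, hB, hR⟩ := h
  have hkpos : 0 < k := Nat.ceil_pos.2 hLpos
  have hkL : (k : ℝ) < L + 1 := Nat.ceil_lt_add_one hLpos.le
  have hm0 : (0 : ℝ) < m := by nlinarith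
  have hkm : k ≤ m := by
    have : (k : ℝ) ≤ m := by nlinarith
    exact_mod_cast this
  set t := 2 * √2 * Real.exp 1 * s * √((1 + L) / m) with ht
  have htpos : 0 < t := by positivity
  have ht2 : t ^ 2 = 8 * Real.exp 2 * s ^ 2 * ((1 + L) / m) := by
    rw [ht]
    have he : Real.exp 1 ^ 2 = Real.exp 2 := by rw [← Real.exp_nat_mul]; norm_num
    simp only [mul_pow]
    rw [Real.sq_sqrt (by positivity), Real.sq_sqrt (by positivity), he]
    ring
  have hvar : Var[id; ν] ≤ s ^ 2 := by
    rw [← Real.sqrt_le_left hs.le]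
    exact hτ
  refine (IsMedianOfMeans.pi_lt_abs_sub_le ν hB hR fun j => ?_).trans
    (ENNReal.ofReal_le_ofReal ?_)
  · have hcard : 1 ≤ m / k := (Nat.one_le_div_iff hkpos).2 hkm
    have hBj : 0 < (B j).card := lt_of_lt_of_le hcard (hB.2.2 j)
    have hBm : (m : ℝ) ≤ 2 * k * (B j).card := by
      have h1 : m < k * (m / k + 1) := by
        have := Nat.lt_div_mul_add (a := m) hkpos
        linarith [mul_comm (m / k) k]
      have h2 : m ≤ 2 * k * (B j).card := by
        have h3 := Nat.mul_le_mul_left k (hB.2.2 j)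
        have h4 := Nat.mul_le_mul_left k hcard
        linarith
      exact_mod_cast h2
    refine (measure_mono fun u (hu : t < _) => le_of_lt hu).trans
      ((pi_le_abs_blockMean_sub_le ν hν hBj htpos).trans (ENNReal.ofReal_le_ofReal ?_))
    have hBpos : (0 : ℝ) < (B j).card := by exact_mod_cast hBj
    have hlow : 4 * Real.exp 2 * s ^ 2 ≤ (B j).card * t ^ 2 := by
      rw [ht2]
      have : (1 : ℝ) ≤ 2 * ((B j).card * ((1 + L) / m)) := by
        rw [← mul_div_assoc, ← mul_div_assoc, le_div_iff₀ hm0]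
        nlinarith
      have h3 : 0 < 4 * Real.exp 2 * s ^ 2 := by positivity
      nlinarith
    rw [div_le_iff₀ (by positivity), Real.exp_neg]
    refine hvar.trans ?_
    have h5 := Real.exp_pos 2
    calc s ^ 2 = (Real.exp 2)⁻¹ / 4 * (4 * Real.exp 2 * s ^ 2) := by field_simp
      _ ≤ _ := by gcongr
  · rw [← hexp]
    exact Real.exp_le_exp.2 (neg_le_neg (Nat.le_ceil L))

theorem log_two_div (hη : 0 < η) : Real.log (2 / η) = Real.log 2 + Real.log (1 / η) := by
  rw [← Real.log_mul (by norm_num) (by positivity)]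
  ring_nf

theorem exp_neg_log_two_div (hη : 0 < η) : Real.exp (-Real.log (2 / η)) = η / 2 := by
  rw [← Real.log_inv, Real.exp_log (by positivity), inv_div]

/-- With `q = 2 log (2/η) / m`, the exponential moment bounds at `v = μ ± a q` are both
`-q / 2` per observation, so the estimate is within `a q = s (q / (1 - q))^{1/2}` of `μ`. -/
theorem IsCatoni.meanGuarantee (hη : 0 < η) (hη1 : η < 1) (hs : 0 < s)
    (hm : 8 * (1 + Real.log (1 / η)) ≤ m) {q : ℝ} (hq : q = 2 * Real.log (2 / η) / m)
    (h : IsCatoni (s / √(q * (1 - q))) R) :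
    MeanGuarantee lawStd 2 η s R := by
  intro ν _ hν hτ
  obtain ⟨ρ, hρ, hd, hlog, hR⟩ := h
  rw [log_two_div hη] at hq
  set L := Real.log (1 / η) with hL
  have hLpos : 0 < L := Real.log_pos (by rw [one_div]; exact (one_lt_inv₀ hη).2 hη1)
  have hm0 : (0 : ℝ) < m := by nlinarith
  have hl2 : 0 < Real.log 2 := Real.log_pos one_lt_two
  have hl2' : Real.log 2 < 1 := by linarith [Real.log_two_lt_d9]
  have hqpos : 0 < q := by rw [hq]; positivity
  have hqL : q ≤ 2 * ((1 + L) / m) := by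
    rw [hq, ← mul_div_assoc]
    gcongr
  have hLm : (1 + L) / m ≤ 1 / 8 := by rw [div_le_div_iff₀ hm0 (by norm_num)]; linarith
  have hq2 : q ≤ 1 / 4 := by linarith
  have hqq : 0 < q * (1 - q) := mul_pos hqpos (by linarith)
  set a := s / √(q * (1 - q)) with ha
  have hapos : 0 < a := div_pos hs (Real.sqrt_pos.2 hqq)
  have ha2 : a ^ 2 = s ^ 2 / (q * (1 - q)) := by rw [ha, div_pow, Real.sq_sqrt hqq.le]
  have hvar : Var[id; ν] ≤ s ^ 2 := by
    rw [← Real.sqrt_le_left hs.le]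
    exact hτ
  have hva : Var[id; ν] / (2 * a ^ 2) ≤ q * (1 - q) / 2 := by
    have h1q : 0 < 1 - q := by linarith
    rw [div_le_iff₀ (by positivity), ha2]
    refine hvar.trans_eq ?_
    field_simp
  have hml : m * (q / 2) = Real.log (2 / η) := by
    rw [log_two_div hη, hq, ← hL]
    field_simp
  set μ := ∫ x, x ∂ν with hμ
  have hmono : Monotone (deriv ρ) := by
    have := hρ.monotoneOn_deriv fun x _ => hd x
    rwa [monotoneOn_univ] at this
  have hexp := exp_neg_log_two_div hη
  have hsq : ∀ b : ℝ, b ^ 2 = (a * q) ^ 2 →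
      (Var[id; ν] + b ^ 2) / (2 * a ^ 2) ≤ q / 2 := by
    intro b hb
    have : (a * q) ^ 2 / (2 * a ^ 2) = q ^ 2 / 2 := by field_simp
    rw [hb, add_div, this]
    nlinarith
  refine measure_lt_abs_le _ (fun u => R u - μ) (t := a * q) ?_ ?_ ?_ hη
  · rw [← hexp]
    refine (measure_mono fun u hu => ?_).trans
      (pi_le_sum_logBounds_le ν hν hmono.measurable (fun x => (hlog x).2) (v := μ + a * q)
        (a := a) (t := 0) ?_)
    · refine (sum_deriv_of_isMin hρ hd hapos (hR u) _).1 ?_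
      have : a * q ≤ R u - μ := hu
      linarith
    · rw [integral_sub_sq ν hν, ← hμ, ← hml]
      have h1 := hsq (μ - (μ + a * q)) (by ring)
      have h2 : (μ - (μ + a * q)) / a = -q := by field_simp; ring
      rw [h2]
      nlinarith
  · rw [← hexp]
    refine (measure_mono fun u hu => ?_).trans
      (pi_le_sum_logBounds_le ν hν (ψ := fun x => -deriv ρ (-x)) (by
          exact (hmono.measurable.comp measurable_neg).neg)
        (fun x => (hlog.neg_comp_neg x).2) (v := μ - a * q) (a := -a) (t := 0) ?_)
    · have h1 : R u - μ ≤ -(a * q) := hu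
      have h2 := (sum_deriv_of_isMin hρ hd hapos (hR u) (μ - a * q)).2 (by linarith)
      simp only [Set.mem_ofPred_eq, div_neg, neg_neg, Finset.sum_neg_distrib]
      linarith
    · rw [integral_sub_sq ν hν, ← hμ, ← hml]
      have h1 := hsq (μ - (μ - a * q)) (by ring)
      have h2 : (μ - (μ - a * q)) / (-a) = -q := by field_simp; ring
      rw [h2, neg_sq]
      nlinarith
  · have haq : a * q = s * √(q / (1 - q)) := by
      have h1q : 0 < 1 - q := by linarith
      rw [ha, Real.sqrt_mul hqpos.le, Real.sqrt_div hqpos.le]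
      have h3 := Real.sq_sqrt hqpos.le
      have h4 := Real.sqrt_pos.2 hqpos
      have h5 := Real.sqrt_pos.2 h1q
      field_simp
      exact h3.symm
    rw [haq, mul_comm 2 s, mul_assoc]
    refine mul_le_mul_of_nonneg_left ?_ hs.le
    rw [← Real.sqrt_sq (show (0 : ℝ) ≤ 2 by norm_num), ← Real.sqrt_mul (by norm_num)]
    refine Real.sqrt_le_sqrt ?_
    rw [div_le_iff₀ (by linarith)]
    nlinarith

/-- Markov's inequality for the exponential of the sum of truncated observations at
`t = 2 a log (2/η) / m = s (2 log (2/η) / m)^{1/2}`. -/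
theorem IsSoftTruncation.meanGuarantee (hη : 0 < η) (hη1 : η < 1) (hs : 0 < s) (hm : 0 < m)
    (h : IsSoftTruncation (s * √(m / (2 * Real.log (2 / η)))) R) :
    MeanGuarantee lawRms (√2) η s R := by
  intro ν _ hν hτ
  obtain ⟨ψ, hmono, hlog, hR⟩ := h
  have hLpos : 0 < Real.log (1 / η) :=
    Real.log_pos (by rw [one_div]; exact (one_lt_inv₀ hη).2 hη1)
  have hl2 : 0 < Real.log 2 := Real.log_pos one_lt_two
  have hl2' : Real.log 2 < 1 := by linarith [Real.log_two_lt_d9]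
  have hexp := exp_neg_log_two_div hη
  have hlL := log_two_div hη
  set L := Real.log (1 / η) with hL
  set l := Real.log (2 / η) with hl
  have hlpos : 0 < l := by rw [hlL]; positivity
  have hm0 : (0 : ℝ) < m := by exact_mod_cast hm
  set a := s * √(m / (2 * l)) with ha
  have hapos : 0 < a := by positivity
  have ha2 : a ^ 2 = s ^ 2 * (m / (2 * l)) := by rw [ha, mul_pow, Real.sq_sqrt (by positivity)]
  have hrms : ∫ x, x ^ 2 ∂ν ≤ s ^ 2 := by
    rw [← Real.sqrt_le_left hs.le]
    exact hτ
  have hra : m * ((∫ x, x ^ 2 ∂ν) / (2 * a ^ 2)) ≤ l := by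
    rw [ha2, ← mul_div_assoc, div_le_iff₀ (by positivity)]
    field_simp
    linarith
  set μ := ∫ x, x ∂ν with hμ
  refine measure_lt_abs_le _ (fun u => R u - μ) (t := 2 * l * a / m) ?_ ?_ ?_ hη
  · rw [← hexp]
    refine (measure_mono fun u hu => ?_).trans
      (pi_le_sum_logBounds_le ν hν hmono.measurable (fun x => (hlog x).2) (v := 0)
        (a := a) (t := m * μ / a + 2 * l) ?_)
    · have h1 : 2 * l * a / m ≤ R u - μ := hu
      rw [hR u] at h1
      have h2 := mul_le_mul_of_nonneg_left h1 (show 0 ≤ m / a by positivity)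
      have h3 : m / a * (2 * l * a / m) = 2 * l := by field_simp
      have h4 : m / a * (a / m * ∑ i, ψ (u i / a) - μ) = ∑ i, ψ (u i / a) - m * μ / a := by
        field_simp
      simp only [Set.mem_ofPred_eq, sub_zero]
      linarith
    · simp only [sub_zero]
      rw [← hμ, mul_add, mul_div_assoc]
      linarith
  · rw [← hexp]
    refine (measure_mono fun u hu => ?_).trans
      (pi_le_sum_logBounds_le ν hν (ψ := fun x => -ψ (-x)) (by
          exact (hmono.measurable.comp measurable_neg).neg)
        (fun x => (hlog.neg_comp_neg x).2) (v := 0) (a := -a) (t := -(m * μ / a) + 2 * l) ?_)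
    · have h1 : R u - μ ≤ -(2 * l * a / m) := hu
      rw [hR u] at h1
      have h2 := mul_le_mul_of_nonneg_left h1 (show 0 ≤ m / a by positivity)
      have h3 : m / a * -(2 * l * a / m) = -(2 * l) := by field_simp
      have h4 : m / a * (a / m * ∑ i, ψ (u i / a) - μ) = ∑ i, ψ (u i / a) - m * μ / a := by
        field_simp
      simp only [Set.mem_ofPred_eq, sub_zero, div_neg, neg_neg, Finset.sum_neg_distrib]
      linarith
    · simp only [sub_zero, neg_sq]
      rw [← hμ, mul_add, div_neg, mul_neg, mul_div_assoc]
      linarith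
  · have h1 : 2 * l * a / m = √2 * s * √(l / m) := by
      rw [ha, Real.sqrt_div hm0.le, Real.sqrt_mul (by norm_num), Real.sqrt_div hlpos.le]
      have h2 := Real.sq_sqrt (show (0 : ℝ) ≤ 2 by norm_num)
      have h3 := Real.sq_sqrt hlpos.le
      have h4 := Real.sq_sqrt hm0.le
      have h5 := Real.sqrt_pos.2 hlpos
      have h6 := Real.sqrt_pos.2 hm0
      have h7 := Real.sqrt_pos.2 (show (0 : ℝ) < 2 by norm_num)
      field_simp
      rw [h2, h3, h4]
    rw [h1]
    gcongr
    linarith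

/-- Each of the specific sub-routines obeys the general guarantee. -/
theorem RobustMean.meanGuarantee {σ r c : ℝ} (hη : 0 < η) (hη1 : η < 1) (hσ : 0 < σ) (hr : 0 < r)
    (hm : 8 * (1 + Real.log (1 / η)) ≤ m) (h : RobustMean η σ r R c s) :
    s = σ ∧ MeanGuarantee lawStd c η s R ∨ s = r ∧ MeanGuarantee lawRms c η s R := by
  have hLpos : 0 < Real.log (1 / η) :=
    Real.log_pos (by rw [one_div]; exact (one_lt_inv₀ hη).2 hη1)
  cases h with
  | ofStd hc h => exact Or.inl ⟨rfl, h⟩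
  | ofRms hc h => exact Or.inr ⟨rfl, h⟩
  | medianOfMeans h => exact Or.inl ⟨rfl, h.meanGuarantee hη hη1 hσ (by linarith)⟩
  | catoni hx h => exact Or.inl ⟨rfl, h.meanGuarantee hη hη1 hσ hm hx⟩
  | softTruncation h =>
    refine Or.inr ⟨rfl, h.meanGuarantee hη hη1 hr ?_⟩
    have : (0 : ℝ) < m := by linarith
    exact_mod_cast this

end Guarantee

/-! ### Quantiles and tail means -/

section Quantile

variable {S : Type*} [MeasurableSpace S] {P : Measure S} [IsProbabilityMeasure P] {X : S → ℝ}

theorem distFun_mono : Monotone (distFun P X) := fun _ _ h =>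
  measureReal_mono fun _ hz => le_trans hz h

theorem distFun_eq_cdf (hX : Measurable X) : distFun P X = cdf (P.map X) := by
  have := Measure.isProbabilityMeasure_map (μ := P) hX.aemeasurable
  funext u
  rw [cdf_eq_real, map_measureReal_apply hX measurableSet_Iic]
  rfl

/-- The infimum in the definition of the value-at-risk is attained, by right continuity. -/
theorem valueAtRisk_le_iff (hX : Measurable X) {a : ℝ} (ha : 0 < a) (ha1 : a < 1) {u : ℝ} :
    valueAtRisk P a X ≤ u ↔ 1 - a ≤ distFun P X u := by
  have := Measure.isProbabilityMeasure_map (μ := P) hX.aemeasurable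
  have hne : {u : ℝ | 1 - a ≤ distFun P X u}.Nonempty := by
    have h := (tendsto_cdf_atTop (P.map X)).eventually (eventually_gt_nhds (sub_lt_self 1 ha))
    obtain ⟨x, hx⟩ := h.exists
    exact ⟨x, by rw [← distFun_eq_cdf hX] at hx; exact hx.le⟩
  have hbdd : BddBelow {u : ℝ | 1 - a ≤ distFun P X u} := by
    have h := (tendsto_cdf_atBot (P.map X)).eventually (eventually_lt_nhds (sub_pos.2 ha1))
    obtain ⟨x, hx⟩ := h.exists
    rw [← distFun_eq_cdf hX] at hx
    exact ⟨x, fun y hy => le_of_lt (distFun_mono.reflect_lt (hx.trans_le hy))⟩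
  refine ⟨fun h => ?_, fun h => csInf_le hbdd h⟩
  have hr : Filter.Tendsto (distFun P X) (nhdsWithin u (Set.Ioi u)) (nhds (distFun P X u)) := by
    rw [distFun_eq_cdf hX]
    exact ((cdf (P.map X)).right_continuous u).mono_left (nhdsWithin_mono _ Set.Ioi_subset_Ici_self)
  refine ge_of_tendsto hr (Filter.eventually_of_mem self_mem_nhdsWithin fun y hy => ?_)
  obtain ⟨x, hx, hxy⟩ := exists_lt_of_csInf_lt hne (h.trans_lt hy)
  exact le_trans hx (distFun_mono hxy.le)

theorem valueAtRisk_anti (hX : Measurable X) {a b : ℝ} (ha : 0 < a) (hab : a ≤ b) (hb : b < 1) :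
    valueAtRisk P b X ≤ valueAtRisk P a X := by
  rw [valueAtRisk_le_iff hX (ha.trans_le hab) hb]
  have := (valueAtRisk_le_iff (P := P) hX ha (hab.trans_lt hb)).1 le_rfl
  linarith

theorem valueAtRisk_nonneg (hX : Measurable X) (hX0 : ∀ z, 0 ≤ X z) {a : ℝ} (ha : 0 < a)
    (ha1 : a < 1) : 0 ≤ valueAtRisk P a X := by
  by_contra! h
  have h1 := (valueAtRisk_le_iff (P := P) hX ha ha1).1 le_rfl
  have h2 : {z | X z ≤ valueAtRisk P a X} = ∅ := by
    ext z
    simpa using h.trans_le (hX0 z)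
  rw [distFun, h2] at h1
  simp at h1
  linarith

/-- A continuous distribution has no atoms. -/
theorem measureReal_lt_eq_distFun (hF : Continuous (distFun P X)) (u : ℝ) :
    P.real {z | X z < u} = distFun P X u := by
  refine le_antisymm (measureReal_mono fun z (hz : _ < u) => hz.le) ?_
  have h : Filter.Tendsto (distFun P X) (nhdsWithin u (Set.Iio u)) (nhds (distFun P X u)) :=
    (hF.tendsto u).mono_left nhdsWithin_le_nhds
  exact le_of_tendsto h (Filter.eventually_of_mem self_mem_nhdsWithin fun y (hy : y < u) =>
    measureReal_mono fun z (hz : X z ≤ y) => hz.trans_lt hy)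

theorem measureReal_ge_eq (hX : Measurable X) (hF : Continuous (distFun P X)) (u : ℝ) :
    P.real {z | u ≤ X z} = 1 - distFun P X u := by
  rw [← measureReal_lt_eq_distFun hF, ← probReal_compl_eq_one_sub
    (measurableSet_lt hX measurable_const)]
  congr 1
  ext z
  simp

theorem distFun_valueAtRisk (hX : Measurable X) (hF : Continuous (distFun P X)) {a : ℝ}
    (ha : 0 < a) (ha1 : a < 1) : distFun P X (valueAtRisk P a X) = 1 - a := by
  refine le_antisymm ?_ ((valueAtRisk_le_iff hX ha ha1).1 le_rfl)
  have h : Filter.Tendsto (distFun P X) (nhdsWithin (valueAtRisk P a X)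
      (Set.Iio (valueAtRisk P a X))) (nhds (distFun P X (valueAtRisk P a X))) :=
    (hF.tendsto _).mono_left nhdsWithin_le_nhds
  refine le_of_tendsto h (Filter.eventually_of_mem self_mem_nhdsWithin fun y hy => ?_)
  exact le_of_lt (not_le.1 fun hle => absurd ((valueAtRisk_le_iff hX ha ha1).2 hle) (not_le.2 hy))

/-- The mean of the upper tail above the threshold `v`. -/
noncomputable def tailMean (P : Measure S) (X : S → ℝ) (v : ℝ) : ℝ := ∫ z in {z | v ≤ X z}, X z ∂P

theorem mul_cvar {S : Type*} [MeasurableSpace S] {P : Measure S} {X : S → ℝ} {α : ℝ} (hα : 0 < α) :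
    α * cvar P α X = tailMean P X (valueAtRisk P α X) := by
  rw [cvar, tailMean]
  field_simp

theorem tailMean_sub (hX : Measurable X) (hX0 : ∀ z, 0 ≤ X z) (hXi : Integrable X P)
    (hF : Continuous (distFun P X)) {v v' : ℝ} (h : v ≤ v') :
    0 ≤ tailMean P X v - tailMean P X v' ∧
      tailMean P X v - tailMean P X v' ≤ v' * (distFun P X v' - distFun P X v) := by
  have hm : ∀ v, MeasurableSet {z | v ≤ X z} := fun v => measurableSet_le measurable_const hX
  have hsub : {z | v' ≤ X z} ⊆ {z | v ≤ X z} := fun z hz => h.trans hz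
  have hd : tailMean P X v - tailMean P X v' = ∫ z in {z | v ≤ X z} \ {z | v' ≤ X z}, X z ∂P := by
    rw [tailMean, tailMean, setIntegral_sdiff (hm v') hXi.integrableOn hsub]
  rw [hd]
  refine ⟨setIntegral_nonneg ((hm v).diff (hm v')) fun z _ => hX0 z, ?_⟩
  have hPd : P.real ({z | v ≤ X z} \ {z | v' ≤ X z}) = distFun P X v' - distFun P X v := by
    rw [measureReal_sdiff hsub (hm v'), measureReal_ge_eq hX hF, measureReal_ge_eq hX hF]
    ring
  calc ∫ z in {z | v ≤ X z} \ {z | v' ≤ X z}, X z ∂P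
      ≤ ∫ z in {z | v ≤ X z} \ {z | v' ≤ X z}, v' ∂P := by
        refine setIntegral_mono_on hXi.integrableOn (integrable_const v').integrableOn
          ((hm v).diff (hm v')) fun z hz => (not_le.1 hz.2).le
    _ = _ := by rw [setIntegral_const, hPd, smul_eq_mul, mul_comm]

theorem abs_tailMean_sub_le (hX : Measurable X) (hX0 : ∀ z, 0 ≤ X z) (hXi : Integrable X P)
    (hF : Continuous (distFun P X)) {v v' b : ℝ} (hv : v ≤ b) (hv' : v' ≤ b) :
    |tailMean P X v - tailMean P X v'| ≤ b * |distFun P X v - distFun P X v'| := by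
  rcases le_total v v' with h | h
  · have h1 := tailMean_sub hX hX0 hXi hF h
    have h2 := distFun_mono (P := P) (X := X) h
    rw [abs_of_nonneg h1.1, abs_of_nonpos (by linarith)]
    nlinarith [h1.2]
  · have h1 := tailMean_sub hX hX0 hXi hF h
    have h2 := distFun_mono (P := P) (X := X) h
    rw [abs_sub_comm, abs_of_nonneg h1.1, abs_of_nonneg (by linarith)]
    nlinarith [h1.2]

theorem antitone_tailMean (hX : Measurable X) (hX0 : ∀ z, 0 ≤ X z) (hXi : Integrable X P)
    (hF : Continuous (distFun P X)) : Antitone (tailMean P X) := fun _ _ h =>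
  sub_nonneg.1 (tailMean_sub hX hX0 hXi hF h).1

theorem LocalGrowth.distFun_add {α γ lam : ℝ} (h : LocalGrowth P α γ lam X) (hX : Measurable X)
    (hF : Continuous (distFun P X)) (hα : 0 < α) (hα1 : α < 1) {u : ℝ} (hu : 0 ≤ u)
    (hu1 : u ≤ 1) : 1 - α + γ * u ≤ distFun P X (valueAtRisk P α X + u) := by
  have h1 := (h u (by rwa [abs_of_nonneg hu])).1
  have h2 := distFun_mono (P := P) (X := X) (le_add_of_nonneg_right hu :
    valueAtRisk P α X ≤ valueAtRisk P α X + u)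
  rw [abs_of_nonneg hu, abs_of_nonneg (by linarith), distFun_valueAtRisk hX hF hα hα1] at h1
  linarith

theorem LocalGrowth.distFun_sub {α γ lam : ℝ} (h : LocalGrowth P α γ lam X) (hX : Measurable X)
    (hF : Continuous (distFun P X)) (hα : 0 < α) (hα1 : α < 1) {u : ℝ} (hu : 0 ≤ u)
    (hu1 : u ≤ 1) : distFun P X (valueAtRisk P α X - u) ≤ 1 - α - γ * u := by
  have h1 := (h (-u) (by rwa [abs_neg, abs_of_nonneg hu])).1
  rw [← sub_eq_add_neg] at h1
  have h2 := distFun_mono (P := P) (X := X) (sub_le_self _ hu :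
    valueAtRisk P α X - u ≤ valueAtRisk P α X)
  rw [abs_neg, abs_of_nonneg hu, abs_of_nonpos (by linarith), distFun_valueAtRisk hX hF hα hα1]
    at h1
  linarith

end Quantile

/-! ### Order statistics -/

section OrderStat

theorem orderStat_le_iff {l : ℕ} (Y : Fin l → ℝ) {j : ℕ} (hj : j - 1 < l) {v : ℝ} :
    orderStat Y j ≤ v ↔ j - 1 < (Finset.univ.filter fun i => Y i ≤ v).card := by
  rw [orderStat, dif_pos hj]
  have h := Tuple.lt_card_le_iff_apply_le_of_monotone (j := ⟨j - 1, hj⟩) (f := Y ∘ Tuple.sort Y)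
    (a := v) (Tuple.monotone_sort Y)
  rw [Function.comp_apply] at h
  rw [← h]
  have hc : (Finset.univ.filter fun i => (Y ∘ Tuple.sort Y) i ≤ v).card =
      (Finset.univ.filter fun i => Y i ≤ v).card :=
    Finset.card_equiv (Tuple.sort Y) (by simp)
  rw [← hc]

theorem measurable_orderStat {l : ℕ} (j : ℕ) :
    Measurable fun Y : Fin l → ℝ => orderStat Y j := by
  by_cases hj : j - 1 < l
  · refine measurable_of_Iic fun v => ?_
    have : (fun Y : Fin l → ℝ => orderStat Y j) ⁻¹' Set.Iic v =
        {Y | ((j - 1 : ℕ) : ℝ) < ∑ i, (if Y i ≤ v then 1 else 0 : ℝ)} := by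
      ext Y
      rw [Set.mem_preimage, Set.mem_Iic, orderStat_le_iff Y hj, Set.mem_ofPred_eq,
        Finset.sum_boole, Nat.cast_lt]
    rw [this]
    refine measurableSet_lt measurable_const (Finset.measurable_sum _ fun i _ => ?_)
    exact Measurable.ite (measurableSet_le (measurable_pi_apply i) measurable_const)
      measurable_const measurable_const
  · have : (fun Y : Fin l → ℝ => orderStat Y j) = fun _ => 0 := by
      funext Y
      rw [orderStat, dif_neg hj]
    rw [this]
    exact measurable_const

theorem measurable_scaledCVaREst {m l : ℕ} {R : (Fin m → ℝ) → ℝ} (hR : Measurable R) (α : ℝ) :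
    Measurable fun p : (Fin m → ℝ) × (Fin l → ℝ) => scaledCVaREst R α p.1 p.2 := by
  refine hR.comp (measurable_pi_lambda _ fun i => ?_)
  have h1 : Measurable fun p : (Fin m → ℝ) × (Fin l → ℝ) => p.1 i := by fun_prop
  exact Measurable.ite (measurableSet_le ((measurable_orderStat _).comp measurable_snd) h1) h1
    measurable_const

end OrderStat

/-! ### Deviation of the empirical quantile -/

section EmpiricalQuantile

variable {S : Type*} [MeasurableSpace S] {P : Measure S} [IsProbabilityMeasure P] {l : ℕ}

/-- The number of observations in `A`. -/
noncomputable def countIn {S : Type*} {l : ℕ} (A : Set S) (z : Fin l → S) : ℝ := ∑ i, A.indicator (fun _ => (1 : ℝ)) (z i)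

theorem countIn_compl {S : Type*} {l : ℕ} (A : Set S) (z : Fin l → S) : countIn Aᶜ z = l - countIn A z := by
  rw [countIn, countIn, eq_sub_iff_add_eq, ← Finset.sum_add_distrib]
  simp [Set.indicator_compl_add_self_apply]

/-- Multiplicative Chernoff bound. -/
theorem pi_le_mul_countIn {A : Set S} (hA : MeasurableSet A) (θ t : ℝ) :
    (Measure.pi fun _ : Fin l => P) {z | t ≤ θ * countIn A z} ≤
      ENNReal.ofReal (Real.exp (l * (P.real A * (Real.exp θ - 1)) - t)) := by
  have hm : Measurable fun z => θ * A.indicator (fun _ => (1 : ℝ)) z :=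
    (measurable_const.indicator hA).const_mul θ
  have h := pi_le_sum_le_exp P (ι := Fin l) (t := t) hm (b := P.real A * (Real.exp θ - 1)) ?_
  · simpa only [Fintype.card_fin, countIn, Finset.mul_sum] using h
  · have he : ∀ z, Real.exp (θ * A.indicator (fun _ => (1 : ℝ)) z) =
        1 + A.indicator (fun _ => Real.exp θ - 1) z := by
      intro z
      by_cases hz : z ∈ A <;> simp [hz]
    simp_rw [he]
    have hi : Integrable (fun z => A.indicator (fun _ => Real.exp θ - 1) z) P :=
      (integrable_const _).indicator hA
    have hi' : Integrable (fun z => 1 + A.indicator (fun _ => Real.exp θ - 1) z) P :=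
      (integrable_const 1).add hi
    rw [← ofReal_integral_eq_lintegral_ofReal hi' (Filter.Eventually.of_forall fun z => by
        simp only [Pi.zero_apply]; rw [← he]; exact (Real.exp_pos _).le)]
    refine ENNReal.ofReal_le_ofReal ?_
    rw [integral_add (integrable_const 1) hi, integral_indicator_const _ hA]
    simp only [integral_const, probReal_univ, smul_eq_mul, mul_one]
    linarith [Real.add_one_le_exp (P.real A * (Real.exp θ - 1))]

/-- Hoeffding's inequality for the number of observations in `A`. -/
theorem pi_le_countIn_sub {A : Set S} (hA : MeasurableSet A) {ε : ℝ} (hε : 0 ≤ ε) :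
    (Measure.pi fun _ : Fin l => P) {z | ε ≤ countIn A z - l * P.real A} ≤
      ENNReal.ofReal (Real.exp (-(2 * ε ^ 2 / l))) := by
  have hm : Measurable (A.indicator fun _ => (1 : ℝ)) := measurable_const.indicator hA
  have hmi : Measurable fun z => A.indicator (fun _ => (1 : ℝ)) z - P.real A := hm.sub_const _
  have hind : iIndepFun (fun (i : Fin l) (z : Fin l → S) =>
      A.indicator (fun _ => (1 : ℝ)) (z i) - P.real A) (Measure.pi fun _ => P) :=
    iIndepFun_pi (μ := fun _ : Fin l => P) fun _ => hmi.aemeasurable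
  have hsub : HasSubgaussianMGF (fun z => A.indicator (fun _ => (1 : ℝ)) z - P.real A)
      ((‖(1 : ℝ) - 0‖₊ / 2) ^ 2) P := by
    have h := hasSubgaussianMGF_of_mem_Icc (μ := P) (a := 0) (b := 1) hm.aemeasurable
      (Filter.Eventually.of_forall fun z => by
        by_cases hz : z ∈ A <;> simp [hz])
    rwa [integral_indicator_const _ hA, smul_eq_mul, mul_one] at h
  have hs : ∀ i ∈ (Finset.univ : Finset (Fin l)), HasSubgaussianMGF (fun z : Fin l → S =>
      A.indicator (fun _ => (1 : ℝ)) (z i) - P.real A) ((‖(1 : ℝ) - 0‖₊ / 2) ^ 2)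
      (Measure.pi fun _ => P) := fun i _ => by
    have he := measurePreserving_eval (fun _ : Fin l => P) i
    refine HasSubgaussianMGF.of_map (Y := Function.eval i)
      (X := fun s => A.indicator (fun _ => (1 : ℝ)) s - P.real A) he.measurable.aemeasurable ?_
    rw [he.map_eq]
    exact hsub
  have h := HasSubgaussianMGF.measure_sum_ge_le_of_iIndepFun hind hs hε
  have hset : {z : Fin l → S | ε ≤ countIn A z - l * P.real A} =
      {z | ε ≤ ∑ i, (A.indicator (fun _ => (1 : ℝ)) (z i) - P.real A)} := by
    ext z
    simp [countIn, Finset.sum_sub_distrib]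
  rw [hset, ← ENNReal.ofReal_toReal (measure_ne_top _ _)]
  refine ENNReal.ofReal_le_ofReal (h.trans_eq ?_)
  congr 1
  simp only [sub_zero, nnnorm_one, Finset.sum_const, Finset.card_univ, Fintype.card_fin,
    nsmul_eq_mul]
  push_cast
  ring_nf

end EmpiricalQuantile

section QuantileDeviation

variable {S : Type*} [MeasurableSpace S] {P : Measure S} [IsProbabilityMeasure P] {X : S → ℝ}
  {l : ℕ} {α : ℝ}

/-- The empirical quantile used as threshold by the validation step: the `⌊(1 - α) l⌋`-th smallest
of `l` observed losses. -/
noncomputable def empQuantile {S : Type*} {l : ℕ} (α : ℝ) (X : S → ℝ) (z : Fin l → S) : ℝ :=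
  orderStat (fun i => X (z i)) ⌊(1 - α) * l⌋₊

theorem countIn_le_eq_card {S : Type*} {l : ℕ} (X : S → ℝ) (v : ℝ) (z : Fin l → S) :
    countIn {s | X s ≤ v} z = (Finset.univ.filter fun i => X (z i) ≤ v).card := by
  simp [countIn, Set.indicator_apply, Finset.sum_boole]

theorem empQuantile_le_iff {S : Type*} {X : S → ℝ} {l : ℕ} (hα : 0 < α) (hl : 1 ≤ (1 - α) * l) {v : ℝ} {z : Fin l → S} :
    empQuantile α X z ≤ v ↔ (⌊(1 - α) * l⌋₊ : ℝ) ≤ countIn {s | X s ≤ v} z := by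
  have h1 : 1 ≤ ⌊(1 - α) * l⌋₊ := Nat.le_floor (by simpa using hl)
  have h2 : ⌊(1 - α) * l⌋₊ ≤ l := by
    refine Nat.floor_le_of_le ?_
    have : (0 : ℝ) ≤ l := Nat.cast_nonneg l
    nlinarith
  rw [empQuantile, orderStat_le_iff _ (by omega), countIn_le_eq_card, Nat.cast_le]
  omega

theorem le_countIn_of_lt_empQuantile {S : Type*} {X : S → ℝ} {l : ℕ}
    (hα : 0 < α) (hl : 1 ≤ (1 - α) * l) {v : ℝ} {z : Fin l → S}
    (h : v < empQuantile α X z) : α * l ≤ countIn {s | X s ≤ v}ᶜ z := by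
  rw [← not_le, empQuantile_le_iff hα hl, not_le] at h
  have := Nat.floor_le (show 0 ≤ (1 - α) * l by linarith)
  rw [countIn_compl]
  linarith

theorem le_countIn_of_empQuantile_le {S : Type*} {X : S → ℝ} {l : ℕ}
    (hα : 0 < α) (hl : 1 ≤ (1 - α) * l) {v : ℝ} {z : Fin l → S}
    (h : empQuantile α X z ≤ v) : (1 - α) * l - 1 ≤ countIn {s | X s ≤ v} z := by
  rw [empQuantile_le_iff hα hl] at h
  have := Nat.lt_floor_add_one ((1 - α) * l)
  linarith

theorem measurable_empQuantile (hX : Measurable X) :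
    Measurable fun z : Fin l → S => empQuantile α X z :=
  (measurable_orderStat _).comp (measurable_pi_lambda _ fun i => hX.comp (measurable_pi_apply i))

theorem measureReal_compl_le (hX : Measurable X) (v : ℝ) :
    P.real {s | X s ≤ v}ᶜ = 1 - distFun P X v :=
  probReal_compl_eq_one_sub (measurableSet_le hX measurable_const)

/-- With high probability, the empirical quantile is close to the value-at-risk at level `α`, and
lies between those at levels `2 α` and `α / 2`. -/
theorem pi_empQuantile_deviation_le (hX : Measurable X) (hF : Continuous (distFun P X))
    (hα : 0 < α) (hα' : α < 1 / 2) {γ lam : ℝ} (hγ : 0 < γ) (hg : LocalGrowth P α γ lam X)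
    {L m : ℝ} (hL : 0 < L) (hml : m ≤ l) (hm1 : (1 + L) * (1 / (2 * γ ^ 2)) ≤ m)
    (hm2 : (1 + L) * (16 / (3 * α)) ≤ m) :
    (Measure.pi fun _ : Fin l => P) {z | ¬ (|empQuantile α X z - valueAtRisk P α X| ≤
        √((1 + L) / (2 * m)) / γ ∧ valueAtRisk P (2 * α) X ≤ empQuantile α X z ∧
        empQuantile α X z ≤ valueAtRisk P (α / 2) X)} ≤
      4 * ENNReal.ofReal (Real.exp (-L)) := by
  have hαm : 16 / 3 * (1 + L) ≤ α * m := by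
    have h : α * ((1 + L) * (16 / (3 * α))) = 16 / 3 * (1 + L) := by field_simp
    rw [← h]
    exact mul_le_mul_of_nonneg_left hm2 hα.le
  have hmpos : 0 < m := by
    by_contra! h
    nlinarith
  have hlpos : (0 : ℝ) < l := hmpos.trans_le hml
  have hαl : 16 / 3 * (1 + L) ≤ α * l := hαm.trans (mul_le_mul_of_nonneg_left hml hα.le)
  have hl1 : 1 ≤ (1 - α) * l := by nlinarith
  have hmL : 32 / 3 * (1 + L) ≤ m := by nlinarith
  set x := √((1 + L) / (2 * m)) with hx
  have hx0 : 0 < x := Real.sqrt_pos.2 (by positivity)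
  have hx2 : x ^ 2 = (1 + L) / (2 * m) := Real.sq_sqrt (by positivity)
  have hx2m : 2 * m * x ^ 2 = 1 + L := by rw [hx2]; field_simp
  have hx4 : x ≤ 1 / 4 := by
    refine (sq_le_sq₀ hx0.le (by norm_num)).1 ?_
    rw [hx2, div_le_iff₀ (by positivity)]
    linarith
  have hmx : 1 ≤ m * x := by nlinarith
  have hxγ : x ≤ γ := by
    have h1 : x ^ 2 ≤ γ ^ 2 := by
      rw [hx2, div_le_iff₀ (by positivity)]
      have h2 : 2 * γ ^ 2 * ((1 + L) * (1 / (2 * γ ^ 2))) = 1 + L := by field_simp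
      nlinarith [mul_le_mul_of_nonneg_left hm1 (show 0 ≤ 2 * γ ^ 2 by positivity)]
    exact (sq_le_sq₀ hx0.le hγ.le).1 h1
  have hu0 : 0 ≤ x / γ := by positivity
  have hu1 : x / γ ≤ 1 := (div_le_one hγ).2 hxγ
  have hγu : γ * (x / γ) = x := by field_simp
  have hα1 : α < 1 := by linarith
  set V := valueAtRisk P α X with hV
  have hlog := Real.log_two_gt_d9
  have hlog' := Real.log_two_lt_d9
  have hms : ∀ v, MeasurableSet {s | X s ≤ v} := fun v => measurableSet_le hX measurable_const
  have hup := hg.distFun_add hX hF hα hα1 hu0 hu1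
  have hlo := hg.distFun_sub hX hF hα hα1 hu0 hu1
  rw [hγu] at hup hlo
  have hlx : 1 ≤ l * x := hmx.trans (mul_le_mul_of_nonneg_right hml hx0.le)
  have hlx2 : 1 + L ≤ 2 * l * x ^ 2 := by
    rw [← hx2m]
    gcongr
  -- Hoeffding's inequality, upper deviation
  have h1 : (Measure.pi fun _ : Fin l => P) {z | V + x / γ < empQuantile α X z} ≤
      ENNReal.ofReal (Real.exp (-L)) := by
    refine (measure_mono fun z hz => ?_).trans ((pi_le_countIn_sub (P := P) (l := l)
      (hms (V + x / γ)).compl (show 0 ≤ l * x by positivity)).trans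
      (ENNReal.ofReal_le_ofReal (Real.exp_le_exp.2 ?_)))
    · have h := le_countIn_of_lt_empQuantile hα hl1 hz
      simp only [Set.mem_ofPred_eq]
      rw [measureReal_compl_le hX]
      nlinarith
    · have : 2 * (l * x) ^ 2 / l = 2 * l * x ^ 2 := by field_simp
      rw [this]
      linarith
  -- the lower deviation loses one observation to the rounding of `(1 - α) l`
  have h2 : (Measure.pi fun _ : Fin l => P) {z | empQuantile α X z ≤ V - x / γ} ≤
      ENNReal.ofReal (Real.exp (-L)) := by
    refine (measure_mono fun z hz => ?_).trans ((pi_le_countIn_sub (P := P) (l := l)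
      (hms (V - x / γ)) (show 0 ≤ l * x - 1 by linarith)).trans
      (ENNReal.ofReal_le_ofReal (Real.exp_le_exp.2 ?_)))
    · have h := le_countIn_of_empQuantile_le hα hl1 hz
      have h' : P.real {s | X s ≤ V - x / γ} ≤ 1 - α - x := hlo
      simp only [Set.mem_ofPred_eq]
      nlinarith
    · have : 2 * (l * x - 1) ^ 2 / l = 2 * l * x ^ 2 - 4 * x + 2 / l := by
        field_simp
        ring
      rw [this]
      have : 0 < 2 / (l : ℝ) := by positivity
      linarith
  -- Chernoff's bound with parameters `log 2` and `-log 2`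
  have h3 : (Measure.pi fun _ : Fin l => P)
      {z | valueAtRisk P (α / 2) X < empQuantile α X z} ≤ ENNReal.ofReal (Real.exp (-L)) := by
    refine (measure_mono fun z hz => ?_).trans ((pi_le_mul_countIn (P := P) (l := l)
      (hms (valueAtRisk P (α / 2) X)).compl (Real.log 2) (Real.log 2 * (α * l))).trans
      (ENNReal.ofReal_le_ofReal (Real.exp_le_exp.2 ?_)))
    · exact mul_le_mul_of_nonneg_left (le_countIn_of_lt_empQuantile hα hl1 hz) (by linarith)
    · rw [measureReal_compl_le hX, distFun_valueAtRisk hX hF (by linarith) (by linarith),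
        Real.exp_log two_pos]
      nlinarith
  have h4 : (Measure.pi fun _ : Fin l => P)
      {z | empQuantile α X z ≤ valueAtRisk P (2 * α) X} ≤ ENNReal.ofReal (Real.exp (-L)) := by
    refine (measure_mono fun z hz => ?_).trans ((pi_le_mul_countIn (P := P) (l := l)
      (hms (valueAtRisk P (2 * α) X)).compl (-Real.log 2) (-Real.log 2 * (α * l + 1))).trans
      (ENNReal.ofReal_le_ofReal (Real.exp_le_exp.2 ?_)))
    · have h := le_countIn_of_empQuantile_le hα hl1 hz
      have h' : countIn {s | X s ≤ valueAtRisk P (2 * α) X}ᶜ z ≤ α * l + 1 := by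
        rw [countIn_compl]
        linarith
      exact mul_le_mul_of_nonpos_left h' (by linarith : -Real.log 2 ≤ 0)
    · rw [measureReal_compl_le hX, distFun_valueAtRisk hX hF (by linarith) (by linarith),
        Real.exp_neg, Real.exp_log two_pos]
      nlinarith
  have hsub : {z : Fin l → S | ¬ (|empQuantile α X z - V| ≤ x / γ ∧
      valueAtRisk P (2 * α) X ≤ empQuantile α X z ∧
      empQuantile α X z ≤ valueAtRisk P (α / 2) X)} ⊆
      (({z | V + x / γ < empQuantile α X z} ∪ {z | empQuantile α X z ≤ V - x / γ}) ∪
        {z | valueAtRisk P (α / 2) X < empQuantile α X z}) ∪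
        {z | empQuantile α X z ≤ valueAtRisk P (2 * α) X} := by
    intro z hz
    by_contra hcon
    simp only [Set.mem_union, Set.mem_ofPred_eq, not_or, not_lt, not_le] at hcon
    obtain ⟨⟨⟨c1, c2⟩, c3⟩, c4⟩ := hcon
    exact hz ⟨abs_le.2 ⟨by linarith, by linarith⟩, c4.le, c3⟩
  refine (measure_mono hsub).trans ((measure_union_le _ _).trans ?_)
  refine (add_le_add ((measure_union_le _ _).trans (add_le_add ((measure_union_le _ _).trans
    (add_le_add h1 h2)) h3)) h4).trans_eq ?_
  ring

end QuantileDeviation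

/-! ### Validation error -/

section Validation

variable {S : Type*} [MeasurableSpace S] {P : Measure S} {X : S → ℝ} {α : ℝ}

/-- The loss with its values below the threshold `v` replaced by zero. -/
noncomputable def truncBelow {S : Type*} (X : S → ℝ) (v : ℝ) (z : S) : ℝ :=
  if v ≤ X z then X z else 0

theorem truncBelow_eq_indicator {S : Type*} (X : S → ℝ) (v : ℝ) :
    truncBelow X v = {z | v ≤ X z}.indicator X := by
  funext z
  simp [truncBelow, Set.indicator_apply]

theorem measurable_truncBelow (hX : Measurable X) (v : ℝ) : Measurable (truncBelow X v) :=
  Measurable.ite (measurableSet_le measurable_const hX) hX measurable_const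

theorem integral_truncBelow (hX : Measurable X) (v : ℝ) :
    ∫ z, truncBelow X v z ∂P = tailMean P X v := by
  rw [truncBelow_eq_indicator, integral_indicator (measurableSet_le measurable_const hX), tailMean]

theorem integral_truncBelow_sq (hX : Measurable X) (v : ℝ) :
    ∫ z, truncBelow X v z ^ 2 ∂P = ∫ z in {z | v ≤ X z}, X z ^ 2 ∂P := by
  rw [← integral_indicator (measurableSet_le measurable_const hX)]
  refine integral_congr_ae (Filter.Eventually.of_forall fun z => ?_)
  by_cases h : v ≤ X z <;> simp [truncBelow, h]

theorem memLp_truncBelow (hX : Measurable X) (hX2 : MemLp X 2 P) (v : ℝ) :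
    MemLp (truncBelow X v) 2 P := by
  rw [truncBelow_eq_indicator]
  exact hX2.indicator (measurableSet_le measurable_const hX)

theorem lawRms_truncBelow_le (hX : Measurable X) (hX2 : MemLp X 2 P) (v : ℝ) :
    lawRms (P.map (truncBelow X v)) ≤ rootMeanSq P X := by
  refine Real.sqrt_le_sqrt ?_
  rw [integral_map (measurable_truncBelow hX v).aemeasurable (by fun_prop),
    integral_truncBelow_sq hX]
  exact setIntegral_le_integral hX2.integrable_sq
    (Filter.Eventually.of_forall fun z => sq_nonneg _)

variable [IsProbabilityMeasure P]

/-- Between the quantiles of levels `2 α` and `α / 2`, the truncated loss has standard deviation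
at most `σ_α`. -/
theorem lawStd_truncBelow_le (hX : Measurable X) (hX0 : ∀ z, 0 ≤ X z) (hX2 : MemLp X 2 P)
    (hF : Continuous (distFun P X)) {v : ℝ} (h1 : valueAtRisk P (2 * α) X ≤ v)
    (h2 : v ≤ valueAtRisk P (α / 2) X) :
    lawStd (P.map (truncBelow X v)) ≤ tailStd P α X := by
  have hv := measurable_truncBelow hX v
  have hms : ∀ v, MeasurableSet {s | v ≤ X s} := fun v => measurableSet_le measurable_const hX
  refine Real.sqrt_le_sqrt ?_
  rw [variance_map aemeasurable_id hv.aemeasurable, Function.id_comp,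
    variance_eq_sub (memLp_truncBelow hX hX2 v)]
  simp only [Pi.pow_apply]
  rw [integral_truncBelow hX, integral_truncBelow_sq hX]
  have hXi : Integrable X P := hX2.integrable (by norm_num)
  have ha : ∫ z in {z | v ≤ X z}, X z ^ 2 ∂P ≤
      ∫ z in {z | valueAtRisk P (2 * α) X ≤ X z}, X z ^ 2 ∂P :=
    setIntegral_mono_set hX2.integrable_sq.integrableOn
      (Filter.Eventually.of_forall fun z => sq_nonneg _)
      (Filter.Eventually.of_forall fun z (hz : v ≤ X z) => h1.trans hz)
  have hb : tailMean P X (valueAtRisk P (α / 2) X) ≤ tailMean P X v :=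
    antitone_tailMean hX hX0 hXi hF h2
  have hc : 0 ≤ tailMean P X (valueAtRisk P (α / 2) X) :=
    setIntegral_nonneg (hms _) fun z _ => hX0 z
  have hd := pow_le_pow_left₀ hc hb 2
  rw [tailMean] at hd
  linarith

/-- The guarantee of the mean estimator, for the truncated loss at a fixed threshold. -/
theorem MeanGuarantee.truncBelow {τ : Measure ℝ → ℝ} {m : ℕ} {c η s : ℝ} {R : (Fin m → ℝ) → ℝ}
    (h : MeanGuarantee τ c η s R) (hX : Measurable X) (hX2 : MemLp X 2 P) {v : ℝ}
    (hτ : τ (P.map (truncBelow X v)) ≤ s) :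
    (Measure.pi fun _ : Fin m => P) {z | c * s * √((1 + Real.log (1 / η)) / m) <
      |R (fun i => CVaRLearning.truncBelow X v (z i)) - tailMean P X v|} ≤ ENNReal.ofReal η := by
  have hv := measurable_truncBelow hX v
  have := Measure.isProbabilityMeasure_map (μ := P) hv.aemeasurable
  have hLp : MemLp id 2 (P.map (CVaRLearning.truncBelow X v)) :=
    (memLp_map_measure_iff aestronglyMeasurable_id hv.aemeasurable).2 (memLp_truncBelow hX hX2 v)
  have hmean : ∫ x, x ∂(P.map (CVaRLearning.truncBelow X v)) = tailMean P X v := by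
    rw [integral_map hv.aemeasurable (by fun_prop), integral_truncBelow hX]
  have hg := h (P.map (CVaRLearning.truncBelow X v)) hLp hτ
  rw [hmean, ← Measure.pi_map_pi fun _ => hv.aemeasurable] at hg
  have hvm : Measurable fun (z : Fin m → S) i => CVaRLearning.truncBelow X v (z i) :=
    measurable_pi_lambda _ fun i => hv.comp (measurable_pi_apply i)
  exact (Measure.le_map_apply (f := fun (z : Fin m → S) i => CVaRLearning.truncBelow X v (z i))
    hvm.aemeasurable {u | c * s * √((1 + Real.log (1 / η)) / m) < |R u - tailMean P X v|}).trans hg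

theorem validate_eq {S : Type*} {n : ℕ} (R : (Fin (n / 2) → ℝ) → ℝ) (α : ℝ) (X : S → ℝ)
    (z : Fin n → S) : validate R α X z = R fun i => truncBelow X
      (empQuantile α X fun i : Fin (n - n / 2) => z ⟨n / 2 + i, by omega⟩)
      (z (Fin.castLE (Nat.div_le_self n 2) i)) := rfl

/-- Accuracy of the validation score of a fixed candidate. -/
theorem pi_lt_abs_validate_sub_le {n : ℕ} (hX : Measurable X) (hX0 : ∀ z, 0 ≤ X z)
    (hX2 : MemLp X 2 P) (hF : Continuous (distFun P X)) (hα : 0 < α) (hα' : α < 1 / 2)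
    {γ lam b : ℝ} (hγ : 0 < γ) (hlam : 0 < lam) (hg : LocalGrowth P α γ lam X)
    (hb : valueAtRisk P (α / 2) X ≤ b)
    {η c s : ℝ} (hη : 0 < η) (hη1 : η < 1)
    (hn : (1 + Real.log (1 / η)) * max (1 / (2 * γ ^ 2)) (16 / (3 * α)) ≤ (n / 2 : ℕ))
    {R : (Fin (n / 2) → ℝ) → ℝ} (hR : Measurable R)
    (hRc : MeanGuarantee lawStd c η s R ∧ tailStd P α X ≤ s ∨
      MeanGuarantee lawRms c η s R ∧ rootMeanSq P X ≤ s) :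
    (Measure.pi fun _ : Fin n => P) {z | (c * s + b * lam / (√2 * γ)) *
        √((1 + Real.log (1 / η)) / (n / 2 : ℕ)) < |validate R α X z - α * cvar P α X|} ≤
      5 * ENNReal.ofReal η := by
  classical
  set L := Real.log (1 / η) with hL
  have hLpos : 0 < L := Real.log_pos (by rw [one_div]; exact (one_lt_inv₀ hη).2 hη1)
  have hexp : Real.exp (-L) = η := by
    rw [hL, one_div, Real.log_inv, neg_neg, Real.exp_log hη]
  have hn1 : (1 + L) * (1 / (2 * γ ^ 2)) ≤ (n / 2 : ℕ) :=
    (mul_le_mul_of_nonneg_left (le_max_left _ _) (by linarith)).trans hn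
  have hn2 : (1 + L) * (16 / (3 * α)) ≤ (n / 2 : ℕ) :=
    (mul_le_mul_of_nonneg_left (le_max_right _ _) (by linarith)).trans hn
  have hml : ((n / 2 : ℕ) : ℝ) ≤ (n - n / 2 : ℕ) := by
    have : n / 2 ≤ n - n / 2 := by omega
    exact_mod_cast this
  have hmpos : (0 : ℝ) < (n / 2 : ℕ) := lt_of_lt_of_le (by positivity) hn2
  have hXi : Integrable X P := hX2.integrable (by norm_num)
  let e₁ : Fin (n / 2) → Fin n := Fin.castLE (Nat.div_le_self n 2)
  let e₂ : Fin (n - n / 2) → Fin n := fun i => ⟨n / 2 + i, by omega⟩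
  have he₁ : Function.Injective e₁ := Fin.castLE_injective _
  have he₂ : Function.Injective e₂ := fun i j hij => by
    simp only [e₂, Fin.mk.injEq] at hij
    exact Fin.ext (by omega)
  set t := c * s * √((1 + L) / (n / 2 : ℕ)) with ht
  set V := valueAtRisk P α X with hV
  set x := √((1 + L) / (2 * (n / 2 : ℕ))) with hx
  have hxeq : x = √((1 + L) / (n / 2 : ℕ)) / √2 := by
    rw [hx, mul_comm, ← div_div, Real.sqrt_div (by positivity)]
  let Good : ℝ → Prop := fun v => |v - V| ≤ x / γ ∧ valueAtRisk P (2 * α) X ≤ v ∧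
    v ≤ valueAtRisk P (α / 2) X
  have hxγ : x / γ ≤ 1 := by
    rw [div_le_one hγ]
    have h1 : x ^ 2 ≤ γ ^ 2 := by
      rw [Real.sq_sqrt (by positivity), div_le_iff₀ (by positivity)]
      have h2 : 2 * γ ^ 2 * ((1 + L) * (1 / (2 * γ ^ 2))) = 1 + L := by field_simp
      nlinarith [mul_le_mul_of_nonneg_left hn1 (show 0 ≤ 2 * γ ^ 2 by positivity)]
    exact (sq_le_sq₀ (Real.sqrt_nonneg _) hγ.le).1 h1
  -- the bias caused by the error of the threshold
  have hbias : ∀ v, Good v → |tailMean P X v - tailMean P X V| ≤ b * lam / (√2 * γ) *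
      √((1 + L) / (n / 2 : ℕ)) := by
    rintro v ⟨hv1, -, hv2⟩
    have hVb : V ≤ b := (valueAtRisk_anti hX (by linarith) (by linarith) (by linarith)).trans hb
    have hb0 : 0 ≤ b :=
      (valueAtRisk_nonneg hX hX0 (by linarith) (by linarith : α / 2 < 1)).trans hb
    have h1 := abs_tailMean_sub_le hX hX0 hXi hF (hv2.trans hb) hVb
    have h2 := (hg (v - V) (hv1.trans hxγ)).2
    rw [← hV, add_sub_cancel] at h2
    have h3 : |distFun P X v - distFun P X V| ≤ lam * (x / γ) :=
      h2.trans (mul_le_mul_of_nonneg_left hv1 hlam.le)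
    refine h1.trans ((mul_le_mul_of_nonneg_left h3 hb0).trans_eq ?_)
    rw [hxeq]
    field_simp
  -- the event that the threshold is inaccurate
  set E₂ : Set (Fin n → S) := {z | ¬ Good (empQuantile α X (z ∘ e₂))} with hE₂
  have hE₂le : (Measure.pi fun _ : Fin n => P) E₂ ≤ 4 * ENNReal.ofReal η := by
    have h := pi_empQuantile_deviation_le (P := P) (l := n - n / 2) hX hF hα hα' hγ hg hLpos hml hn1 hn2
    rw [hexp] at h
    have hmp := measurePreserving_comp_injective P he₂
    refine le_trans ?_ h
    rw [← hmp.map_eq]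
    exact Measure.le_map_apply hmp.measurable.aemeasurable _
  -- the event that the mean estimate is inaccurate, although the threshold is not
  set E₁ : Set ((Fin n → S) × (Fin n → S)) := {p | Good (empQuantile α X (p.2 ∘ e₂))} ∩
    {p | t < |R (fun i => truncBelow X (empQuantile α X (p.2 ∘ e₂)) (p.1 (e₁ i))) -
      tailMean P X (empQuantile α X (p.2 ∘ e₂))|} with hE₁
  have hq : Measurable fun p : (Fin n → S) × (Fin n → S) => empQuantile α X (p.2 ∘ e₂) :=
    (measurable_empQuantile hX).comp
      ((measurePreserving_comp_injective P he₂).measurable.comp measurable_snd)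
  have hE₁m : MeasurableSet E₁ := by
    have hGood : MeasurableSet {v | Good v} :=
      (measurableSet_le (f := fun v => |v - V|) (by fun_prop) measurable_const).inter
        ((measurableSet_le measurable_const measurable_id).inter
          (measurableSet_le measurable_id measurable_const))
    refine (hq hGood).inter (measurableSet_lt measurable_const (Measurable.abs (Measurable.sub ?_ ?_)))
    · refine hR.comp (measurable_pi_lambda _ fun i => ?_)
      have h2 : Measurable fun p : (Fin n → S) × (Fin n → S) => X (p.1 (e₁ i)) :=
        hX.comp ((measurable_pi_apply _).comp measurable_fst)
      exact Measurable.ite (measurableSet_le hq h2) h2 measurable_const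
    · exact (antitone_tailMean hX hX0 hXi hF).measurable.comp hq
  have hE₁le : ((Measure.pi fun _ : Fin n => P).prod (Measure.pi fun _ : Fin n => P)) E₁ ≤
      ENNReal.ofReal η := by
    rw [Measure.prod_apply_symm hE₁m]
    refine (lintegral_mono (g := fun _ => ENNReal.ofReal η) fun z' => ?_).trans (by simp)
    by_cases hgood : Good (empQuantile α X (z' ∘ e₂))
    · set v := empQuantile α X (z' ∘ e₂) with hv
      have hguar : (Measure.pi fun _ : Fin (n / 2) => P) {z | t < |R (fun i => truncBelow X v (z i)) -
          tailMean P X v|} ≤ ENNReal.ofReal η := by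
        rcases hRc with ⟨h1, h2⟩ | ⟨h1, h2⟩
        · exact h1.truncBelow hX hX2
            ((lawStd_truncBelow_le hX hX0 hX2 hF hgood.2.1 hgood.2.2).trans h2)
        · exact h1.truncBelow hX hX2 ((lawRms_truncBelow_le hX hX2 v).trans h2)
      have hmp := measurePreserving_comp_injective P he₁
      rw [← hmp.map_eq] at hguar
      refine le_trans (measure_mono fun z hz => ?_)
        ((Measure.le_map_apply hmp.measurable.aemeasurable _).trans hguar)
      exact hz.2
    · have : (fun z => (z, z')) ⁻¹' E₁ = ∅ := by
        ext z
        simp [hE₁, hgood]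
      rw [this]
      simp
  -- the two halves of the sample are independent
  have hE₁' : (Measure.pi fun _ : Fin n => P) {z | (z, z) ∈ E₁} ≤ ENNReal.ofReal η := by
    have hmp := measurePreserving_piecewise P (Set.range e₁)
    have hmd : MeasurableSet {z : Fin n → S | (z, z) ∈ E₁} :=
      (measurable_id.prodMk measurable_id) hE₁m
    rw [← hmp.measure_preimage hmd.nullMeasurableSet]
    refine le_trans (measure_mono fun p hp => ?_) hE₁le
    have h1 : ∀ i, (Set.range e₁).piecewise p.1 p.2 (e₁ i) = p.1 (e₁ i) := fun i =>
      Set.piecewise_eq_of_mem _ _ _ ⟨i, rfl⟩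
    have h2 : (Set.range e₁).piecewise p.1 p.2 ∘ e₂ = p.2 ∘ e₂ := by
      funext i
      refine Set.piecewise_eq_of_notMem _ _ _ ?_
      rintro ⟨j, hj⟩
      have := congrArg Fin.val hj
      simp only [e₁, e₂, Fin.val_castLE] at this
      omega
    simpa only [hE₁, Set.mem_preimage, Set.mem_inter_iff, Set.mem_ofPred_eq, h1, h2] using hp
  refine (measure_mono (t := E₂ ∪ {z | (z, z) ∈ E₁}) fun z hz => ?_).trans
    ((measure_union_le _ _).trans ((add_le_add hE₂le hE₁').trans_eq (by ring)))
  by_cases hgood : Good (empQuantile α X (z ∘ e₂))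
  · refine Or.inr ⟨hgood, ?_⟩
    have h1 := hbias _ hgood
    simp only [Set.mem_ofPred_eq] at hz
    rw [mul_cvar hα, validate_eq] at hz
    change _ < |R (fun i => truncBelow X (empQuantile α X (z ∘ e₂)) (z (e₁ i))) -
      tailMean P X V| at hz
    have h2 := abs_sub_le (R fun i => truncBelow X (empQuantile α X (z ∘ e₂)) (z (e₁ i)))
      (tailMean P X (empQuantile α X (z ∘ e₂))) (tailMean P X V)
    rw [add_mul] at hz
    change t < |R (fun i => truncBelow X (empQuantile α X (z ∘ e₂)) (z (e₁ i))) -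
      tailMean P X (empQuantile α X (z ∘ e₂))|
    linarith
  · exact Or.inl hgood

end Validation

/-! ### Projected stochastic sub-gradient descent -/

section Projection

variable {d : ℕ} {K : Set (Joint d)}

/-- `proj` is chosen by `Classical.epsilon`; a closest point exists, and it is characterized by the
variational inequality. -/
theorem proj_spec (hK : IsClosed K) (hKc : Convex ℝ K) (hne : K.Nonempty) (x : Joint d) :
    proj K x ∈ K ∧ ∀ y ∈ K, inner ℝ (x - proj K x) (y - proj K x) ≤ 0 := by
  have hbdd : BddBelow (Set.range fun w : K => ‖x - w‖) :=
    ⟨0, by rintro _ ⟨w, rfl⟩; exact norm_nonneg _⟩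
  obtain ⟨v, hv, hmin⟩ := exists_norm_eq_iInf_of_complete_convex hne hK.isComplete hKc x
  have hex : ∃ y, y ∈ K ∧ ∀ y' ∈ K, ‖x - y‖ ≤ ‖x - y'‖ :=
    ⟨v, hv, fun y' hy' => hmin.trans_le (ciInf_le hbdd ⟨y', hy'⟩)⟩
  have h := Classical.epsilon_spec hex
  change proj K x ∈ K ∧ ∀ y' ∈ K, ‖x - proj K x‖ ≤ ‖x - y'‖ at h
  refine ⟨h.1, (norm_eq_iInf_iff_real_inner_le_zero hKc h.1).1 ?_⟩
  have : Nonempty K := ⟨⟨v, hv⟩⟩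
  exact le_antisymm (le_ciInf fun w => h.2 w w.2) (ciInf_le hbdd ⟨_, h.1⟩)

theorem norm_proj_sub_proj_le (hK : IsClosed K) (hKc : Convex ℝ K) (hne : K.Nonempty)
    (x y : Joint d) : ‖proj K x - proj K y‖ ≤ ‖x - y‖ := by
  obtain ⟨hx, hx'⟩ := proj_spec hK hKc hne x
  obtain ⟨hy, hy'⟩ := proj_spec hK hKc hne y
  have h1 := hx' _ hy
  have h2 := hy' _ hx
  set p := proj K x
  set q := proj K y
  have h3 : ‖p - q‖ ^ 2 ≤ inner ℝ (x - y) (p - q) := by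
    rw [← real_inner_self_eq_norm_sq]
    have e1 : inner ℝ (x - p) (q - p) = - inner ℝ (x - p) (p - q) := by
      rw [← inner_neg_right, neg_sub]
    have e2 : inner ℝ (x - y) (p - q) - inner ℝ (p - q) (p - q) =
        inner ℝ (x - p) (p - q) - inner ℝ (y - q) (p - q) := by
      rw [← inner_sub_left, ← inner_sub_left]
      congr 1
      abel
    linarith
  have h4 := real_inner_le_norm (x - y) (p - q)
  by_contra! hlt
  have h5 : 0 < ‖p - q‖ := (norm_nonneg _).trans_lt hlt
  nlinarith

theorem proj_eq_self (hK : IsClosed K) (hKc : Convex ℝ K) {x : Joint d} (hx : x ∈ K) :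
    proj K x = x := by
  have h := (proj_spec hK hKc ⟨x, hx⟩ x).2 x hx
  rw [real_inner_self_eq_norm_sq] at h
  have : ‖x - proj K x‖ = 0 := by nlinarith [norm_nonneg (x - proj K x)]
  exact (sub_eq_zero.1 (norm_eq_zero.1 this)).symm

theorem measurable_proj (hK : IsClosed K) (hKc : Convex ℝ K) (hne : K.Nonempty) :
    Measurable (proj K) := by
  have : LipschitzWith 1 (proj K) := LipschitzWith.of_dist_le_mul fun x y => by
    rw [dist_eq_norm, dist_eq_norm, NNReal.coe_one, one_mul]
    exact norm_proj_sub_proj_le hK hKc hne x y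
  exact this.continuous.measurable

end Projection

section Descent

variable {S : Type*} {d N : ℕ} {K : Set (Joint d)} {G : Joint d → S → Joint d} {β : ℝ}
  {x₀ : Joint d}

theorem sgd_mem (hK : IsClosed K) (hKc : Convex ℝ K) (hx₀ : x₀ ∈ K) (z : Fin N → S) (t : ℕ) :
    sgd K G β x₀ z t ∈ K := by
  induction t with
  | zero => exact hx₀
  | succ t ih =>
    rw [sgd]
    split_ifs with h
    · exact (proj_spec hK hKc ⟨x₀, hx₀⟩ _).1
    · exact ih

theorem sgdAverage_mem (hK : IsClosed K) (hKc : Convex ℝ K) (hx₀ : x₀ ∈ K) (hN : 0 < N)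
    (z : Fin N → S) : sgdAverage K G β x₀ z ∈ K := by
  rw [sgdAverage, Finset.smul_sum]
  have hN' : (N : ℝ) ≠ 0 := by exact_mod_cast hN.ne'
  refine hKc.sum_mem (fun _ _ => by positivity) ?_ fun t _ => sgd_mem hK hKc hx₀ z t
  rw [Finset.sum_const, Finset.card_range, nsmul_eq_mul]
  field_simp

theorem dependsOn_sgd (t : ℕ) :
    DependsOn (fun z : Fin N → S => sgd K G β x₀ z t) {i | (i : ℕ) < t} := by
  induction t with
  | zero => exact fun _ _ _ => rfl
  | succ t ih =>
    intro z z' hz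
    have h1 : sgd K G β x₀ z t = sgd K G β x₀ z' t :=
      ih fun i hi => hz i (Nat.lt_succ_of_lt hi)
    simp only [sgd]
    split_ifs with h
    · rw [h1, hz ⟨t, h⟩ (Nat.lt_succ_self t)]
    · exact h1

theorem measurable_sgd [MeasurableSpace S] (hK : IsClosed K) (hKc : Convex ℝ K)
    (hne : K.Nonempty) (hG : Measurable fun p : Joint d × S => G p.1 p.2) (t : ℕ) :
    Measurable fun z : Fin N → S => sgd K G β x₀ z t := by
  induction t with
  | zero => exact measurable_const
  | succ t ih =>
    by_cases h : t < N
    · simp only [sgd, dif_pos h]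
      exact (measurable_proj hK hKc hne).comp
        (ih.sub ((hG.comp (ih.prodMk (measurable_pi_apply _))).const_smul β))
    · simpa only [sgd, dif_neg h] using ih

theorem measurable_sgdAverage [MeasurableSpace S] (hK : IsClosed K) (hKc : Convex ℝ K)
    (hne : K.Nonempty) (hG : Measurable fun p : Joint d × S => G p.1 p.2) :
    Measurable fun z : Fin N → S => sgdAverage K G β x₀ z :=
  (Finset.measurable_sum (Finset.range N) fun t _ =>
    measurable_sgd (N := N) (β := β) (x₀ := x₀) hK hKc hne hG t).const_smul (1 / (N : ℝ))

variable {f : Joint d → S → ℝ} {M : ℝ}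

/-- The regret of projected sub-gradient descent, for a fixed sequence of observations. -/
theorem sgd_regret (hK : IsClosed K) (hKc : Convex ℝ K) (hx₀ : x₀ ∈ K)
    (hG : ∀ x ∈ K, ∀ s, ∀ y ∈ K, f x s + inner ℝ (G x s) (y - x) ≤ f y s)
    (hM : ∀ x ∈ K, ∀ s, ‖G x s‖ ≤ M) (hβ : 0 ≤ β) {y : Joint d} (hy : y ∈ K) (z : Fin N → S) :
    2 * β * ∑ t : Fin N, (f (sgd K G β x₀ z t) (z t) - f y (z t)) ≤
      ‖x₀ - y‖ ^ 2 + N * (β ^ 2 * M ^ 2) := by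
  have key : ∀ n ≤ N, ‖sgd K G β x₀ z n - y‖ ^ 2 + 2 * β * ∑ t ∈ Finset.range n,
      (if h : t < N then f (sgd K G β x₀ z t) (z ⟨t, h⟩) - f y (z ⟨t, h⟩) else 0) ≤
      ‖x₀ - y‖ ^ 2 + n * (β ^ 2 * M ^ 2) := by
    intro n
    induction n with
    | zero => simp [sgd]
    | succ n ih =>
      intro hn
      have hn' : n < N := hn
      have ih := ih hn'.le
      rw [Finset.sum_range_succ, dif_pos hn']
      set x := sgd K G β x₀ z n with hx
      have hxK : x ∈ K := sgd_mem hK hKc hx₀ z n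
      set g := G x (z ⟨n, hn'⟩) with hg
      have hstep : sgd K G β x₀ z (n + 1) = proj K (x - β • g) := by
        rw [sgd, dif_pos hn']
      have h1 : ‖sgd K G β x₀ z (n + 1) - y‖ ≤ ‖(x - y) - β • g‖ := by
        have := norm_proj_sub_proj_le hK hKc ⟨x₀, hx₀⟩ (x - β • g) y
        rw [proj_eq_self hK hKc hy] at this
        rw [hstep]
        refine this.trans_eq ?_
        congr 1
        abel
      have h2 : ‖(x - y) - β • g‖ ^ 2 =
          ‖x - y‖ ^ 2 - 2 * β * inner ℝ g (x - y) + β ^ 2 * ‖g‖ ^ 2 := by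
        rw [norm_sub_sq_real, inner_smul_right, norm_smul, mul_pow, Real.norm_eq_abs, sq_abs,
          real_inner_comm]
        ring
      have h3 := hG x hxK (z ⟨n, hn'⟩) y hy
      have h4 : inner ℝ g (y - x) = - inner ℝ g (x - y) := by
        rw [← inner_neg_right, neg_sub]
      rw [← hg, h4] at h3
      have h5 : ‖g‖ ^ 2 ≤ M ^ 2 := pow_le_pow_left₀ (norm_nonneg _) (hM x hxK _) 2
      have h6 := pow_le_pow_left₀ (norm_nonneg _) h1 2
      have h7 : β ^ 2 * ‖g‖ ^ 2 ≤ β ^ 2 * M ^ 2 := mul_le_mul_of_nonneg_left h5 (sq_nonneg β)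
      have h8 : 2 * β * (f x (z ⟨n, hn'⟩) - f y (z ⟨n, hn'⟩)) ≤ 2 * β * inner ℝ g (x - y) :=
        mul_le_mul_of_nonneg_left (by linarith) (by linarith)
      push_cast
      rw [h2] at h6
      linarith
  have h := key N le_rfl
  rw [Finset.sum_range] at h
  simp only [Fin.is_lt, dif_pos, Fin.eta] at h
  nlinarith [sq_nonneg ‖sgd K G β x₀ z N - y‖]

theorem abs_sub_le_of_subgradient
    (hG : ∀ x ∈ K, ∀ s, ∀ y ∈ K, f x s + inner ℝ (G x s) (y - x) ≤ f y s)
    (hM : ∀ x ∈ K, ∀ s, ‖G x s‖ ≤ M) {x y : Joint d} (hx : x ∈ K) (hy : y ∈ K) (s : S) :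
    |f x s - f y s| ≤ M * ‖x - y‖ := by
  have key : ∀ x ∈ K, ∀ y ∈ K, f x s - f y s ≤ M * ‖x - y‖ := by
    intro x hx y hy
    have h1 := hG x hx s y hy
    have h2 := real_inner_le_norm (-(G x s)) (y - x)
    rw [inner_neg_left, norm_neg, norm_sub_rev] at h2
    have h3 := mul_le_mul_of_nonneg_right (hM x hx s) (norm_nonneg (x - y))
    linarith
  rw [abs_le]
  have h1 := key x hx y hy
  have h2 := key y hy x hx
  rw [norm_sub_rev] at h2
  exact ⟨by linarith, h1⟩

/-- Jensen's inequality along the trajectory, read off from a sub-gradient at the average. -/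
theorem sgdAverage_sub_le (hK : IsClosed K) (hKc : Convex ℝ K) (hx₀ : x₀ ∈ K) (hN : 0 < N)
    (hG : ∀ x ∈ K, ∀ s, ∀ y ∈ K, f x s + inner ℝ (G x s) (y - x) ≤ f y s)
    (y : Joint d) (z : Fin N → S) (s : S) :
    N * (f (sgdAverage K G β x₀ z) s - f y s) ≤
      ∑ t : Fin N, (f (sgd K G β x₀ z t) s - f y s) := by
  have hN' : (N : ℝ) ≠ 0 := by exact_mod_cast hN.ne'
  set a := sgdAverage K G β x₀ z with ha
  have hmem : a ∈ K := sgdAverage_mem hK hKc hx₀ hN z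
  have h1 : ∑ t : Fin N, (sgd K G β x₀ z t - a) = 0 := by
    rw [Finset.sum_sub_distrib, ← Finset.sum_range (fun t => sgd K G β x₀ z t), Finset.sum_const,
      Finset.card_univ, Fintype.card_fin, ← Nat.cast_smul_eq_nsmul ℝ, ha, sgdAverage, smul_smul,
      mul_one_div_cancel hN', one_smul, sub_self]
  have h2 : ∑ t : Fin N, (f a s - f y s + inner ℝ (G a s) (sgd K G β x₀ z t - a)) ≤
      ∑ t : Fin N, (f (sgd K G β x₀ z t) s - f y s) :=
    Finset.sum_le_sum fun t _ => by
      have := hG a hmem s _ (sgd_mem (β := β) (G := G) hK hKc hx₀ z t)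
      linarith
  rw [Finset.sum_add_distrib, ← inner_sum, h1, inner_zero_right, add_zero, Finset.sum_const,
    Finset.card_univ, Fintype.card_fin, nsmul_eq_mul] at h2
  exact h2

/-- Expected excess of the averaged iterate. -/
theorem integral_sgdAverage_sub_le [MeasurableSpace S] (P : Measure S) [IsProbabilityMeasure P]
    (hK : IsClosed K) (hKc : Convex ℝ K) (hx₀ : x₀ ∈ K) (hN : 0 < N)
    (hf : Measurable fun p : Joint d × S => f p.1 p.2)
    (hGm : Measurable fun p : Joint d × S => G p.1 p.2)
    (hG : ∀ x ∈ K, ∀ s, ∀ y ∈ K, f x s + inner ℝ (G x s) (y - x) ≤ f y s)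
    (hM0 : 0 < M) (hM : ∀ x ∈ K, ∀ s, ‖G x s‖ ≤ M)
    {D : ℝ} (hD0 : 0 < D) (hD : ∀ x ∈ K, ∀ y ∈ K, ‖x - y‖ ≤ D)
    (hβ : β = D / (M * √N)) {y : Joint d} (hy : y ∈ K) :
    ∫ z : Fin N → S, ∫ s, (f (sgdAverage K G β x₀ z) s - f y s) ∂P ∂(Measure.pi fun _ => P) ≤
      D * M / √N := by
  have hne : K.Nonempty := ⟨x₀, hx₀⟩
  have hN' : (0 : ℝ) < N := by exact_mod_cast hN
  have hsN : 0 < √(N : ℝ) := Real.sqrt_pos.2 hN'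
  have hsN2 : √(N : ℝ) ^ 2 = N := Real.sq_sqrt hN'.le
  have hβ0 : 0 < β := by rw [hβ]; positivity
  have hbd : ∀ x ∈ K, ∀ s, |f x s - f y s| ≤ M * D := fun x hx s =>
    (abs_sub_le_of_subgradient hG hM hx hy s).trans
      (mul_le_mul_of_nonneg_left (hD x hx y hy) hM0.le)
  have hfy : Measurable fun p : Joint d × S => f p.1 p.2 - f y p.2 :=
    hf.sub (hf.comp (measurable_const.prodMk measurable_snd))
  have hxt : ∀ t, Measurable fun z : Fin N → S => sgd K G β x₀ z t :=
    measurable_sgd hK hKc hne hGm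
  have hxa : Measurable fun z : Fin N → S => sgdAverage K G β x₀ z :=
    measurable_sgdAverage hK hKc hne hGm
  -- integrability of the inner and outer integrals, from boundedness
  have hinner : ∀ x ∈ K, Integrable (fun s => f x s - f y s) P := fun x hx =>
    Integrable.of_bound (hfy.comp measurable_prodMk_left).aestronglyMeasurable (M * D)
      (Filter.Eventually.of_forall fun s => hbd x hx s)
  have houter : ∀ x : (Fin N → S) → Joint d, Measurable x → (∀ z, x z ∈ K) →
      Integrable (fun z => ∫ s, (f (x z) s - f y s) ∂P) (Measure.pi fun _ : Fin N => P) := by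
    intro x hx hxK
    have h1 : StronglyMeasurable fun z => ∫ s, (f (x z) s - f y s) ∂P := by
      refine StronglyMeasurable.integral_prod_right' (f := fun p : (Fin N → S) × S =>
        f (x p.1) p.2 - f y p.2) ?_
      exact (hfy.comp ((hx.comp measurable_fst).prodMk measurable_snd)).stronglyMeasurable
    refine Integrable.of_bound h1.aestronglyMeasurable (M * D)
      (Filter.Eventually.of_forall fun z => ?_)
    have := norm_integral_le_of_norm_le_const (μ := P) (f := fun s => f (x z) s - f y s)
      (C := M * D) (Filter.Eventually.of_forall fun s => hbd (x z) (hxK z) s)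
    simpa using this
  have hmem : ∀ t (z : Fin N → S), sgd K G β x₀ z t ∈ K := fun t z => sgd_mem hK hKc hx₀ z t
  have hcoord : ∀ t : Fin N, Integrable (fun z : Fin N → S =>
      f (sgd K G β x₀ z t) (z t) - f y (z t)) (Measure.pi fun _ => P) := fun t =>
    Integrable.of_bound (hfy.comp ((hxt t).prodMk (measurable_pi_apply t))).aestronglyMeasurable
      (M * D) (Filter.Eventually.of_forall fun z => hbd _ (hmem t z) _)
  have hstep : ∀ t : Fin N, ∫ z : Fin N → S, (f (sgd K G β x₀ z t) (z t) - f y (z t))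
      ∂(Measure.pi fun _ => P) =
      ∫ z : Fin N → S, ∫ s, (f (sgd K G β x₀ z t) s - f y s) ∂P ∂(Measure.pi fun _ => P) := by
    intro t
    refine integral_pi_eval P t (hxt t) ?_ (h := fun x s => f x s - f y s) hfy
      (fun z s => hbd _ (hmem t z) s)
    refine (dependsOn_sgd (t : ℕ)).mono fun i (hi : (i : ℕ) < t) => ?_
    simp only [Set.mem_compl_iff, Set.mem_singleton_iff]
    rintro rfl
    exact lt_irrefl _ hi
  -- Jensen, then independence of the iterate and the next observation, then the regret bound
  have h1 : N * ∫ z : Fin N → S, ∫ s, (f (sgdAverage K G β x₀ z) s - f y s) ∂P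
      ∂(Measure.pi fun _ => P) ≤ ∑ t : Fin N, ∫ z : Fin N → S,
        ∫ s, (f (sgd K G β x₀ z t) s - f y s) ∂P ∂(Measure.pi fun _ => P) := by
    rw [← integral_finsetSum (f := fun (t : Fin N) (z : Fin N → S) =>
      ∫ s, (f (sgd K G β x₀ z t) s - f y s) ∂P) _ fun t _ => houter _ (hxt t) (hmem t),
      ← integral_const_mul]
    refine integral_mono ((houter _ hxa fun z => sgdAverage_mem hK hKc hx₀ hN z).const_mul _)
      (integrable_finsetSum _ fun t _ => houter _ (hxt t) (hmem t)) fun z => ?_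
    simp only
    rw [← integral_finsetSum (f := fun (t : Fin N) s => f (sgd K G β x₀ z t) s - f y s) _
      fun t _ => hinner _ (hmem t z), ← integral_const_mul]
    exact integral_mono ((hinner _ (sgdAverage_mem hK hKc hx₀ hN z)).const_mul _)
      (integrable_finsetSum _ fun t _ => hinner _ (hmem t z))
      fun s => sgdAverage_sub_le hK hKc hx₀ hN hG y z s
  have h2 : 2 * β * ∑ t : Fin N, ∫ z : Fin N → S, ∫ s, (f (sgd K G β x₀ z t) s - f y s) ∂P
      ∂(Measure.pi fun _ => P) ≤ D ^ 2 + N * (β ^ 2 * M ^ 2) := by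
    simp_rw [← hstep]
    rw [← integral_finsetSum (f := fun (t : Fin N) (z : Fin N → S) =>
      f (sgd K G β x₀ z t) (z t) - f y (z t)) _ fun t _ => hcoord t, ← integral_const_mul]
    have h3 := integral_mono ((integrable_finsetSum _ fun t _ => hcoord t).const_mul (2 * β))
      (integrable_const (μ := Measure.pi fun _ : Fin N => P) (D ^ 2 + N * (β ^ 2 * M ^ 2)))
      fun z => (sgd_regret hK hKc hx₀ hG hM hβ0.le hy z).trans (by
        have := pow_le_pow_left₀ (norm_nonneg _) (hD x₀ hx₀ y hy) 2
        linarith)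
    simpa using h3
  set A := ∫ z : Fin N → S, ∫ s, (f (sgdAverage K G β x₀ z) s - f y s) ∂P
    ∂(Measure.pi fun _ => P) with hA
  have h4 : 2 * β * (N * A) ≤ D ^ 2 + N * (β ^ 2 * M ^ 2) :=
    (mul_le_mul_of_nonneg_left h1 (by linarith)).trans h2
  have h5 : N * (β ^ 2 * M ^ 2) = D ^ 2 := by
    rw [hβ, div_pow, mul_pow, hsN2]
    field_simp
  have h6 : 2 * β * N = 2 * (D * √N / M) := by
    rw [hβ]
    nth_rewrite 2 [← hsN2]
    field_simp
  rw [h5, ← mul_assoc, h6] at h4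
  rw [le_div_iff₀ hsN]
  have h7 : D * √N / M * A ≤ D ^ 2 := by linarith
  rw [div_mul_eq_mul_div, div_le_iff₀ hM0] at h7
  nlinarith

end Descent

/-! ### The joint objective -/

section Objective

variable {S : Type*} {d : ℕ} {W U : Set (Par d)} {loss : Par d → S → ℝ} {α : ℝ} {lamL : NNReal}

theorem norm_sq_eq (x : Joint d) : ‖x‖ ^ 2 = ‖x.fst‖ ^ 2 + x.snd ^ 2 := by
  rw [WithLp.prod_norm_sq_eq_of_L2, Real.norm_eq_abs, sq_abs]

theorem continuous_joint_fst : Continuous fun x : Joint d => x.fst := by fun_prop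

theorem continuous_joint_snd : Continuous fun x : Joint d => x.snd := by fun_prop

/-- Lipschitz constant of the joint objective. -/
noncomputable def jointLip (α : ℝ) (lamL : NNReal) : ℝ := √((lamL : ℝ) ^ 2 + (1 - α) ^ 2) / α

theorem objective_eq_max (hα : 0 < α) (z : S) (x : Joint d) :
    objective α loss z x = max (1 / α * (loss x.fst z - (1 - α) * x.snd)) x.snd := by
  have h : (0 : ℝ) ≤ 1 / α := by positivity
  rw [objective, mul_max_of_nonneg _ _ h, mul_zero, ← max_add_add_left, add_zero]
  congr 1
  field_simp
  ring

/-- The objective is the maximum of two functions: one has the stated constant by the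
Cauchy–Schwarz inequality, the other has constant `1`, which is smaller as `α < 1/2`. -/
theorem abs_objective_sub_le (hα : 0 < α) (hα' : α < 1 / 2) {z : S}
    (hlip : LipschitzOnWith lamL (fun w => loss w z) U) {x y : Joint d} (hx : x.fst ∈ U)
    (hy : y.fst ∈ U) :
    |objective α loss z x - objective α loss z y| ≤ jointLip α lamL * ‖x - y‖ := by
  have h1 := hlip.dist_le_mul _ hx _ hy
  rw [Real.dist_eq, dist_eq_norm, ← WithLp.sub_fst] at h1
  set a := ‖(x - y).fst‖ with ha
  set b := (x - y).snd with hb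
  have hb' : b = x.snd - y.snd := WithLp.sub_snd x y
  have hn : ‖x - y‖ ^ 2 = a ^ 2 + b ^ 2 := norm_sq_eq _
  set L := (lamL : ℝ)
  have hL0 : 0 ≤ L := NNReal.coe_nonneg _
  set Q := √(L ^ 2 + (1 - α) ^ 2) with hQ
  have hQ0 : 0 ≤ Q := Real.sqrt_nonneg _
  have hQ2 : Q ^ 2 = L ^ 2 + (1 - α) ^ 2 := Real.sq_sqrt (by positivity)
  have hn0 : 0 ≤ ‖x - y‖ := norm_nonneg _
  have hcs : (1 - α) * |b| + L * a ≤ Q * ‖x - y‖ := by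
    refine abs_le_of_sq_le_sq' ?_ (by positivity) |>.2
    rw [mul_pow, hn, hQ2, ← sq_abs b]
    nlinarith [sq_nonneg (L * |b| - (1 - α) * a)]
  have ha0 : 0 ≤ a := norm_nonneg _
  rw [objective_eq_max hα, objective_eq_max hα]
  refine (abs_max_sub_max_le_max _ _ _ _).trans (max_le ?_ ?_)
  · rw [← mul_sub, abs_mul, abs_of_pos (by positivity : 0 < 1 / α), div_mul_eq_mul_div, one_mul,
      jointLip, div_mul_eq_mul_div]
    refine div_le_div_of_nonneg_right (le_trans ?_ hcs) hα.le
    have h2 : loss x.fst z - (1 - α) * x.snd - (loss y.fst z - (1 - α) * y.snd) =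
        (loss x.fst z - loss y.fst z) - (1 - α) * b := by rw [hb']; ring
    rw [h2]
    refine (abs_sub _ _).trans ?_
    rw [abs_mul, abs_of_pos (by linarith : 0 < 1 - α)]
    linarith
  · rw [← hb', jointLip, div_mul_eq_mul_div, le_div_iff₀ hα]
    have h3 : 0 ≤ L * a := by positivity
    nlinarith [abs_nonneg b]

/-- Sub-gradients of a Lipschitz function at interior points are bounded by its constant. -/
theorem IsSubgradient.norm_le (hU : IsOpen U) {f : Joint d → ℝ} {M : ℝ} (hM : 0 ≤ M)
    (hf : ∀ x y : Joint d, x.fst ∈ U → y.fst ∈ U → |f x - f y| ≤ M * ‖x - y‖) {x g : Joint d}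
    (hx : x.fst ∈ U) (hg : IsSubgradient {y | y.fst ∈ U} f x g) : ‖g‖ ≤ M := by
  have hcont : Continuous fun t : ℝ => (x + t • g).fst := by fun_prop
  have hev : ∀ᶠ t in nhdsWithin (0 : ℝ) (Set.Ioi 0), (x + t • g).fst ∈ U := by
    refine nhdsWithin_le_nhds (hcont.continuousAt.eventually_mem (hU.mem_nhds ?_))
    simpa using hx
  obtain ⟨t, htU, ht⟩ := (hev.and self_mem_nhdsWithin).exists
  have ht0 : (0 : ℝ) < t := ht
  have h1 := hg _ htU
  have h2 := (le_abs_self _).trans (hf _ _ htU hx)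
  rw [add_sub_cancel_left] at h1 h2
  rw [inner_smul_right, real_inner_self_eq_norm_sq] at h1
  rw [norm_smul, Real.norm_of_nonneg ht0.le] at h2
  by_contra! hlt
  have h3 : t * ‖g‖ ^ 2 ≤ M * (t * ‖g‖) := by linarith
  have h4 := mul_pos ht0 (hM.trans_lt hlt)
  nlinarith

theorem isClosed_feasible (hW : IsClosed W) (V : ℝ) : IsClosed (feasible W V) :=
  (hW.preimage continuous_joint_fst).inter (isClosed_Icc.preimage continuous_joint_snd)

theorem convex_feasible (hW : Convex ℝ W) (V : ℝ) : Convex ℝ (feasible W V) := by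
  intro x hx y hy a b ha hb hab
  exact ⟨hW hx.1 hy.1 ha hb hab, convex_Icc 0 V hx.2 hy.2 ha hb hab⟩

theorem norm_sub_le_of_mem_feasible (hW : Bornology.IsBounded W) {V : ℝ} {x y : Joint d}
    (hx : x ∈ feasible W V) (hy : y ∈ feasible W V) :
    ‖x - y‖ ≤ √(Metric.diam W ^ 2 + V ^ 2) := by
  refine Real.le_sqrt_of_sq_le ?_
  rw [norm_sq_eq, WithLp.sub_fst, WithLp.sub_snd, ← dist_eq_norm]
  have h1 := Metric.dist_le_diam_of_mem hW hx.1 hy.1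
  have h2 := pow_le_pow_left₀ dist_nonneg h1 2
  have hx2 := hx.2
  have hy2 := hy.2
  rw [Set.mem_Icc] at hx2 hy2
  have h3 : (x.snd - y.snd) ^ 2 ≤ V ^ 2 :=
    sq_le_sq' (by linarith) (by linarith)
  linarith

end Objective

section ExpectedObjective

variable {S : Type*} [MeasurableSpace S] {P : Measure S} [IsProbabilityMeasure P] {d : ℕ}
  {W U : Set (Par d)} {loss : Par d → S → ℝ} {α : ℝ} {lamL : NNReal}

/-- The expected objective `𝔼 f_α(w, v; Z)`. -/
noncomputable def expObjective {S : Type*} [MeasurableSpace S] {d : ℕ} (P : Measure S) (α : ℝ)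
    (loss : Par d → S → ℝ) (x : Joint d) : ℝ := ∫ s, objective α loss s x ∂P

theorem measurable_objective {S : Type*} [MeasurableSpace S] {d : ℕ} {loss : Par d → S → ℝ}
    (hmeas : Measurable fun p : Par d × S => loss p.1 p.2) (α : ℝ) :
    Measurable fun p : Joint d × S => objective α loss p.2 p.1 := by
  have h1 : Measurable fun p : Joint d × S => p.1.fst :=
    continuous_joint_fst.measurable.comp measurable_fst
  have h2 : Measurable fun p : Joint d × S => p.1.snd :=
    continuous_joint_snd.measurable.comp measurable_fst
  have h3 : Measurable fun p : Joint d × S => loss p.1.fst p.2 :=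
    hmeas.comp (h1.prodMk measurable_snd)
  unfold objective
  exact h2.add (((h3.sub h2).max measurable_const).const_mul _)

theorem integrable_objective {x : Joint d} (h : Integrable (loss x.fst) P) :
    Integrable (fun s => objective α loss s x) P := by
  unfold objective
  exact (integrable_const _).add (((h.sub (integrable_const _)).pos_part).const_mul _)

theorem measurable_expObjective (hmeas : Measurable fun p : Par d × S => loss p.1 p.2) :
    Measurable (expObjective P α loss) := by
  have h := (measurable_objective hmeas α).stronglyMeasurable
  exact (StronglyMeasurable.integral_prod_right' (f := fun p : Joint d × S =>
    objective α loss p.2 p.1) h).measurable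

/-- Rockafellar–Uryasev: the conditional value-at-risk minimizes the expected objective over `v`,
with minimizer the value-at-risk. -/
theorem cvar_le_expObjective (hα : 0 < α) (hα1 : α < 1) {x : Joint d}
    (hX : Measurable (loss x.fst)) (hXi : Integrable (loss x.fst) P)
    (hF : Continuous (distFun P (loss x.fst))) :
    cvar P α (loss x.fst) ≤ expObjective P α loss x ∧
      (x.snd = valueAtRisk P α (loss x.fst) →
        cvar P α (loss x.fst) = expObjective P α loss x) := by
  set X := loss x.fst with hXdef
  set v := x.snd with hv
  set V := valueAtRisk P α X with hV
  have hms : MeasurableSet {z | V ≤ X z} := measurableSet_le measurable_const hX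
  have hP : P.real {z | V ≤ X z} = α := by
    rw [measureReal_ge_eq hX hF, distFun_valueAtRisk hX hF hα hα1]
    ring
  have hpos : Integrable (fun s => max (X s - v) 0) P :=
    (hXi.sub (integrable_const v)).pos_part
  have hE : expObjective P α loss x = v + 1 / α * ∫ s, max (X s - v) 0 ∂P := by
    unfold expObjective objective
    rw [integral_add (integrable_const _) (hpos.const_mul _), integral_const_mul]
    simp [hv]
  have hT : ∫ z in {z | V ≤ X z}, (X z - v) ∂P = α * cvar P α X - α * v := by
    rw [integral_sub hXi.integrableOn (integrable_const v).integrableOn, setIntegral_const, hP,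
      mul_cvar hα, smul_eq_mul, tailMean]
  have hC : cvar P α X = v + 1 / α * ∫ z in {z | V ≤ X z}, (X z - v) ∂P := by
    rw [hT]
    field_simp
    ring
  rw [hC, hE, ← integral_indicator hms]
  have hind : Integrable ({z | V ≤ X z}.indicator fun z => X z - v) P :=
    (hXi.sub (integrable_const v)).indicator hms
  constructor
  · have := integral_mono hind hpos fun z => by
      by_cases hz : V ≤ X z
      · simp [hz]
      · simp [hz]
    have h1 : 0 ≤ 1 / α := by positivity
    nlinarith [mul_le_mul_of_nonneg_left this h1]
  · intro hvV
    congr 2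
    refine integral_congr_ae (Filter.Eventually.of_forall fun z => ?_)
    by_cases hz : V ≤ X z
    · simp [hz, hvV]
    · simp [hz, hvV, (not_le.1 hz).le]

theorem cvar_nonneg {S : Type*} [MeasurableSpace S] {P : Measure S} {X : S → ℝ} {α : ℝ}
    (hα : 0 < α) (hX0 : ∀ z, 0 ≤ X z) : 0 ≤ cvar P α X :=
  mul_nonneg (by positivity) (integral_nonneg fun z => hX0 z)

/-- Markov's inequality for the excess of the averaged iterate. -/
theorem pi_excess_sgdAverage_le
    (hα : 0 < α) (hα' : α < 1 / 2)
    (hWclosed : IsClosed W) (hWconv : Convex ℝ W) (hWbdd : Bornology.IsBounded W)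
    (hWdiam : 0 < Metric.diam W) (hU : IsOpen U) (hWU : W ⊆ U)
    (hmeas : Measurable fun p : Par d × S => loss p.1 p.2)
    (hlip : ∀ z, LipschitzOnWith lamL (fun w => loss w z) U)
    (hnonneg : ∀ w ∈ W, ∀ z, 0 ≤ loss w z) (hL2 : ∀ w ∈ W, MemLp (loss w) 2 P)
    (hcont : ∀ w ∈ W, Continuous (distFun P (loss w)))
    {V : ℝ} (hV : ∀ w ∈ W, valueAtRisk P α (loss w) ≤ V)
    {x₀ : Joint d} (hx₀ : x₀ ∈ feasible W V)
    {G : Joint d → S → Joint d} (hGmeas : Measurable fun p : Joint d × S => G p.1 p.2)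
    (hG : ∀ x ∈ feasible W V, ∀ z,
      IsSubgradient {y | y.fst ∈ U} (objective α loss z) x (G x z))
    {N : ℕ} (hN : 0 < N) {β : ℝ}
    (hβ : β = α * √((Metric.diam W ^ 2 + V ^ 2) / (((lamL : ℝ) ^ 2 + (1 - α) ^ 2) * N))) :
    (Measure.pi fun _ : Fin N => P) {z | Real.exp 1 / α *
        √(((lamL : ℝ) ^ 2 + (1 - α) ^ 2) * (Metric.diam W ^ 2 + V ^ 2) / N) ≤
      expObjective P α loss (sgdAverage (feasible W V) G β x₀ z) - infOver W loss (cvar P α)} ≤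
      ENNReal.ofReal (Real.exp (-1)) := by
  set K := feasible W V with hKdef
  have hK : IsClosed K := isClosed_feasible hWclosed V
  have hKc : Convex ℝ K := convex_feasible hWconv V
  set D := √(Metric.diam W ^ 2 + V ^ 2) with hD
  set Q := √((lamL : ℝ) ^ 2 + (1 - α) ^ 2) with hQ
  have hD0 : 0 < D := Real.sqrt_pos.2 (by positivity)
  have hQ0 : 0 < Q := Real.sqrt_pos.2 (by
    have : 0 < (1 - α) ^ 2 := by
      have : 0 < 1 - α := by linarith
      positivity
    positivity)
  have hN' : (0 : ℝ) < N := by exact_mod_cast hN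
  have hsN : 0 < √(N : ℝ) := Real.sqrt_pos.2 hN'
  have hM0 : 0 < jointLip α lamL := div_pos hQ0 hα
  have hXm : ∀ w, Measurable (loss w) := fun w => hmeas.comp measurable_prodMk_left
  have hXi : ∀ w ∈ W, Integrable (loss w) P := fun w hw => (hL2 w hw).integrable (by norm_num)
  have hβ' : β = D / (jointLip α lamL * √N) := by
    rw [hβ, Real.sqrt_div (by positivity), Real.sqrt_mul (by positivity), jointLip]
    rw [← hD, ← hQ]
    field_simp
  have hB : √(((lamL : ℝ) ^ 2 + (1 - α) ^ 2) * (Metric.diam W ^ 2 + V ^ 2) / N) =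
      α * (D * jointLip α lamL / √N) := by
    rw [Real.sqrt_div (by positivity), Real.sqrt_mul (by positivity), jointLip]
    rw [← hD, ← hQ]
    field_simp
  set B := D * jointLip α lamL / √N with hBdef
  have hB0 : 0 < B := by positivity
  have hG' : ∀ x ∈ K, ∀ s, ∀ y ∈ K, objective α loss s x + inner ℝ (G x s) (y - x) ≤
      objective α loss s y := fun x hx s y hy => hG x hx s y (hWU hy.1)
  have hM : ∀ x ∈ K, ∀ s, ‖G x s‖ ≤ jointLip α lamL := fun x hx s =>
    (hG x hx s).norm_le hU hM0.le (fun x y hx hy => abs_objective_sub_le hα hα' (hlip s) hx hy)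
      (hWU hx.1)
  set C := infOver W loss (cvar P α) with hC
  have hCle : ∀ w ∈ W, C ≤ cvar P α (loss w) := fun w hw =>
    csInf_le ⟨0, by rintro _ ⟨w, hw, rfl⟩; exact cvar_nonneg hα (hnonneg w hw)⟩ ⟨w, hw, rfl⟩
  have hmem : ∀ z : Fin N → S, sgdAverage K G β x₀ z ∈ K := sgdAverage_mem hK hKc hx₀ hN
  set Φ : (Fin N → S) → ℝ := fun z => expObjective P α loss (sgdAverage K G β x₀ z) with hΦ
  have hΦm : Measurable Φ := (measurable_expObjective hmeas).comp
    (measurable_sgdAverage hK hKc ⟨x₀, hx₀⟩ hGmeas)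
  have hobj : ∀ x ∈ K, Integrable (fun s => objective α loss s x) P := fun x hx =>
    integrable_objective (hXi _ hx.1)
  have hsub : ∀ x ∈ K, ∀ y ∈ K, ∫ s, (objective α loss s x - objective α loss s y) ∂P =
      expObjective P α loss x - expObjective P α loss y := fun x hx y hy =>
    integral_sub (hobj x hx) (hobj y hy)
  have hΦi : Integrable Φ (Measure.pi fun _ : Fin N => P) := by
    refine Integrable.of_bound hΦm.aestronglyMeasurable
      (‖expObjective P α loss x₀‖ + jointLip α lamL * D) (Filter.Eventually.of_forall fun z => ?_)
    have h1 : ‖Φ z - expObjective P α loss x₀‖ ≤ jointLip α lamL * D := by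
      rw [hΦ, ← hsub _ (hmem z) _ hx₀]
      refine (norm_integral_le_of_norm_le_const (C := jointLip α lamL * D)
        (Filter.Eventually.of_forall fun s => ?_)).trans (by simp)
      exact (abs_sub_le_of_subgradient hG' hM (hmem z) hx₀ s).trans
        (mul_le_mul_of_nonneg_left (norm_sub_le_of_mem_feasible hWbdd (hmem z) hx₀) hM0.le)
    have h2 := norm_add_le (expObjective P α loss x₀) (Φ z - expObjective P α loss x₀)
    rw [add_sub_cancel] at h2
    linarith
  -- compare with the pairs `(w, V_α(w))`
  have hmean : ∀ w ∈ W, ∫ z, Φ z ∂(Measure.pi fun _ : Fin N => P) - B ≤ cvar P α (loss w) := by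
    intro w hw
    set y : Joint d := WithLp.toLp 2 (w, valueAtRisk P α (loss w)) with hy
    have hyK : y ∈ K :=
      ⟨hw, valueAtRisk_nonneg (hXm w) (hnonneg w hw) hα (by linarith), hV w hw⟩
    have h1 := integral_sgdAverage_sub_le P (f := fun x s => objective α loss s x) hK hKc hx₀ hN
      (measurable_objective hmeas α) hGmeas hG' hM0 hM hD0
      (fun x hx y hy => norm_sub_le_of_mem_feasible hWbdd hx hy) hβ' hyK
    simp_rw [fun z => hsub _ (hmem z) y hyK] at h1
    rw [integral_sub hΦi (integrable_const _)] at h1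
    have h2 := (cvar_le_expObjective (x := y) hα (by linarith) (hXm w) (hXi w hw) (hcont w hw)).2
      rfl
    change cvar P α (loss w) = _ at h2
    simp only [integral_const, probReal_univ, smul_eq_mul, one_mul] at h1
    linarith
  have hmeanC : ∫ z, (Φ z - C) ∂(Measure.pi fun _ : Fin N => P) ≤ B := by
    rw [integral_sub hΦi (integrable_const _)]
    simp only [integral_const, probReal_univ, smul_eq_mul, one_mul]
    have : ∫ z, Φ z ∂(Measure.pi fun _ : Fin N => P) - B ≤ C := by
      refine le_csInf ⟨_, x₀.fst, hx₀.1, rfl⟩ ?_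
      rintro _ ⟨w, hw, rfl⟩
      exact hmean w hw
    linarith
  have hΦC : ∀ z, 0 ≤ Φ z - C := fun z => by
    have h1 := (cvar_le_expObjective (P := P) (x := sgdAverage K G β x₀ z) hα (by linarith)
      (hXm _) (hXi _ (hmem z).1) (hcont _ (hmem z).1)).1
    have h2 := hCle _ (hmem z).1
    simp only [hΦ]
    linarith
  have hmk := mul_meas_ge_le_integral_of_nonneg (Filter.Eventually.of_forall hΦC)
    (hΦi.sub (integrable_const C)) (Real.exp 1 * B)
  have hset : Real.exp 1 / α * (α * B) = Real.exp 1 * B := by field_simp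
  rw [hB, hset, ← ENNReal.ofReal_toReal (measure_ne_top _ _)]
  refine ENNReal.ofReal_le_ofReal ?_
  change (Measure.pi fun _ : Fin N => P).real {z | Real.exp 1 * B ≤ Φ z - C} ≤ _
  have h3 : Real.exp 1 * B * (Measure.pi fun _ : Fin N => P).real {z | Real.exp 1 * B ≤ Φ z - C} ≤
      B := hmk.trans hmeanC
  rw [Real.exp_neg, ← one_div, le_div_iff₀ (Real.exp_pos 1)]
  have h4 := (Real.exp_pos 1)
  by_contra! hlt
  nlinarith

end ExpectedObjective

/-! ### Constants and uniform bounds over the domain -/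

section Constants

variable {δ : ℝ}

theorem one_le_ceil_log (hδ : 0 < δ) (hδ' : δ < 1) : 1 ≤ ⌈Real.log (1 / δ)⌉₊ :=
  Nat.ceil_pos.2 (Real.log_pos (by rw [one_div]; exact (one_lt_inv₀ hδ).2 hδ'))

theorem subLevel_pos (hδ : 0 < δ) (hδ' : δ < 1) : 0 < subLevel δ := by
  have : (1 : ℝ) ≤ ⌈Real.log (1 / δ)⌉₊ := by exact_mod_cast one_le_ceil_log hδ hδ'
  unfold subLevel
  positivity

theorem subLevel_le (hδ : 0 < δ) (hδ' : δ < 1) : subLevel δ ≤ δ := by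
  have : (1 : ℝ) ≤ ⌈Real.log (1 / δ)⌉₊ := by exact_mod_cast one_le_ceil_log hδ hδ'
  unfold subLevel
  exact div_le_self hδ.le (by linarith)

theorem numParts_eq (δ : ℝ) : numParts δ = ⌈Real.log (1 / subLevel δ)⌉₊ := by
  rw [numParts, subLevel, one_div (_ / _), inv_div]

theorem exp_neg_numParts_le (hδ : 0 < δ) (hδ' : δ < 1) :
    Real.exp (-(numParts δ : ℝ)) ≤ subLevel δ := by
  have hs := subLevel_pos hδ hδ'
  have h := Nat.le_ceil (Real.log (1 / subLevel δ))
  rw [← numParts_eq, one_div, Real.log_inv] at h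
  calc Real.exp (-(numParts δ : ℝ)) ≤ Real.exp (Real.log (subLevel δ)) :=
        Real.exp_le_exp.2 (by linarith)
    _ = subLevel δ := Real.exp_log hs

/-- The number of sub-processes is at most `2 ⌈log (1/δ)⌉`. -/
theorem numParts_mul_subLevel_le (hδ : 0 < δ) (hδ' : δ < 1) : numParts δ * subLevel δ ≤ δ := by
  have h1 := one_le_ceil_log hδ hδ'
  have hle := Nat.le_ceil (Real.log (1 / δ))
  unfold numParts subLevel
  set k := ⌈Real.log (1 / δ)⌉₊
  have hk : (1 : ℝ) ≤ k := by exact_mod_cast h1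
  have hk2 : ⌈Real.log (2 * k / δ)⌉₊ ≤ 2 * k := by
    refine Nat.ceil_le.2 ?_
    have hlog : Real.log (2 * k / δ) = Real.log 2 + Real.log k + Real.log (1 / δ) := by
      rw [← Real.log_mul (by norm_num) (by positivity), ← Real.log_mul (by positivity)
        (by positivity), mul_one_div]
    have h3 := Real.log_le_sub_one_of_pos (show (0 : ℝ) < k by positivity)
    have h4 := Real.log_two_lt_d9
    rw [hlog]
    push_cast
    linarith
  have hk3 : (⌈Real.log (2 * k / δ)⌉₊ : ℝ) ≤ 2 * k := by exact_mod_cast hk2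
  calc (⌈Real.log (2 * k / δ)⌉₊ : ℝ) * (δ / (2 * k)) ≤ 2 * k * (δ / (2 * k)) := by gcongr
    _ = δ := by field_simp

theorem numParts_lt (hδ : 0 < δ) (hδ' : δ < 1) :
    (numParts δ : ℝ) < 1 + Real.log (5 / subLevel δ) := by
  have hs := subLevel_pos hδ hδ'
  have hs1 := (subLevel_le hδ hδ').trans_lt hδ'
  have hpos : 0 ≤ Real.log (1 / subLevel δ) :=
    Real.log_nonneg (by rw [one_div]; exact (one_le_inv₀ hs).2 hs1.le)
  have h := Nat.ceil_lt_add_one hpos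
  rw [← numParts_eq] at h
  have h2 : Real.log (1 / subLevel δ) ≤ Real.log (5 / subLevel δ) :=
    Real.log_le_log (by positivity) (by gcongr; norm_num)
  linarith

end Constants

section Uniform

variable {S : Type*} [MeasurableSpace S] {P : Measure S} [IsProbabilityMeasure P]

/-- By the Cauchy–Schwarz inequality on the event `X ≥ V_{α/2}` of probability `α / 2 < 1`, the
scale `σ_α` does not vanish; a vanishing scale would make the scaling of the estimators void. -/
theorem tailStd_pos {X : S → ℝ} {α : ℝ} (hX : Measurable X) (hX0 : ∀ z, 0 ≤ X z)
    (hX2 : MemLp X 2 P) (hF : Continuous (distFun P X)) (hα : 0 < α) (hα' : α < 1 / 2) :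
    0 < tailStd P α X := by
  have hXi : Integrable X P := hX2.integrable (by norm_num)
  set v := valueAtRisk P (α / 2) X with hv
  have hms : MeasurableSet {z | v ≤ X z} := measurableSet_le measurable_const hX
  have hFv : distFun P X v = 1 - α / 2 := distFun_valueAtRisk hX hF (by linarith) (by linarith)
  have hP : P.real {z | v ≤ X z} = α / 2 := by
    rw [measureReal_ge_eq hX hF, hFv]
    ring
  have hF0 : distFun P X 0 = 0 := by
    rw [← measureReal_lt_eq_distFun hF]
    have : {z | X z < 0} = ∅ := by
      ext z
      simpa using hX0 z
    rw [this, measureReal_empty]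
  have hv0 : 0 < v := by
    by_contra! h
    have := distFun_mono (P := P) (X := X) h
    linarith
  set T := ∫ z in {z | v ≤ X z}, X z ∂P with hT
  have hTpos : 0 < T := by
    have h1 : ∫ z in {z | v ≤ X z}, v ∂P ≤ T :=
      setIntegral_mono_on (integrable_const v).integrableOn hXi.integrableOn hms fun z hz => hz
    rw [setIntegral_const, hP, smul_eq_mul] at h1
    have : 0 < α / 2 * v := by positivity
    linarith
  have hsq : T ^ 2 * (2 / α) ≤ ∫ z in {z | v ≤ X z}, X z ^ 2 ∂P := by
    have h1 : 0 ≤ ∫ z in {z | v ≤ X z}, (X z ^ 2 - (4 / α * T) * X z + (2 / α * T) ^ 2) ∂P :=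
      integral_nonneg fun z => by
        have : X z ^ 2 - (4 / α * T) * X z + (2 / α * T) ^ 2 = (X z - 2 / α * T) ^ 2 := by ring
        simp only [Pi.zero_apply, this]
        positivity
    have i1 : IntegrableOn (fun z => X z ^ 2) {z | v ≤ X z} P := hX2.integrable_sq.integrableOn
    have i2 : IntegrableOn (fun z => (4 / α * T) * X z) {z | v ≤ X z} P :=
      (hXi.const_mul _).integrableOn
    have i3 : IntegrableOn (fun _ => (2 / α * T) ^ 2) {z | v ≤ X z} P :=
      (integrable_const _).integrableOn
    have i4 : IntegrableOn (fun z => X z ^ 2 - (4 / α * T) * X z) {z | v ≤ X z} P := i1.sub i2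
    rw [integral_add i4 i3, integral_sub i1 i2, integral_const_mul, setIntegral_const, hP,
      smul_eq_mul, ← hT] at h1
    have h2 : α / 2 * (2 / α * T) ^ 2 = T ^ 2 * (2 / α) := by field_simp
    have h3 : 4 / α * T * T = 2 * (T ^ 2 * (2 / α)) := by ring
    linarith
  have hmono : ∫ z in {z | v ≤ X z}, X z ^ 2 ∂P ≤
      ∫ z in {z | valueAtRisk P (2 * α) X ≤ X z}, X z ^ 2 ∂P :=
    setIntegral_mono_set hX2.integrable_sq.integrableOn
      (Filter.Eventually.of_forall fun z => sq_nonneg _)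
      (Filter.Eventually.of_forall fun z (hz : v ≤ X z) =>
        (valueAtRisk_anti hX (by linarith) (by linarith) (by linarith)).trans hz)
  refine Real.sqrt_pos.2 ?_
  have h2 : 1 < 2 / α := by rw [lt_div_iff₀ hα]; linarith
  have h3 : T ^ 2 < T ^ 2 * (2 / α) := lt_mul_of_one_lt_right (by positivity) h2
  linarith

theorem tailStd_le_rootMeanSq {S : Type*} [MeasurableSpace S] {P : Measure S} {X : S → ℝ} {α : ℝ} (hX2 : MemLp X 2 P) :
    tailStd P α X ≤ rootMeanSq P X := by
  refine Real.sqrt_le_sqrt ?_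
  have h := setIntegral_le_integral (s := {z | valueAtRisk P (2 * α) X ≤ X z}) hX2.integrable_sq
    (Filter.Eventually.of_forall fun z => sq_nonneg _)
  have h2 := sq_nonneg (∫ z in {z | valueAtRisk P (α / 2) X ≤ X z}, X z ∂P)
  linarith

variable {d : ℕ} {W U : Set (Par d)} {loss : Par d → S → ℝ} {α : ℝ} {lamL : NNReal}

theorem loss_le_add {S : Type*} {loss : Par d → S → ℝ} (hWbdd : Bornology.IsBounded W)
    (hWU : W ⊆ U) (hlip : ∀ z, LipschitzOnWith lamL (fun w => loss w z) U) {w w' : Par d}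
    (hw : w ∈ W) (hw' : w' ∈ W) (z : S) : loss w z ≤ loss w' z + lamL * Metric.diam W := by
  have h := (hlip z).dist_le_mul _ (hWU hw) _ (hWU hw')
  rw [Real.dist_eq] at h
  have h2 := mul_le_mul_of_nonneg_left (Metric.dist_le_diam_of_mem hWbdd hw hw')
    (NNReal.coe_nonneg lamL)
  linarith [le_abs_self (loss w z - loss w' z)]

theorem bddAbove_rootMeanSq (hWbdd : Bornology.IsBounded W) (hWU : W ⊆ U)
    (hlip : ∀ z, LipschitzOnWith lamL (fun w => loss w z) U)
    (hnonneg : ∀ w ∈ W, ∀ z, 0 ≤ loss w z) (hL2 : ∀ w ∈ W, MemLp (loss w) 2 P) {w₀ : Par d}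
    (hw₀ : w₀ ∈ W) : BddAbove ((fun w => rootMeanSq P (loss w)) '' W) := by
  refine ⟨√(∫ z, (loss w₀ z + lamL * Metric.diam W) ^ 2 ∂P), ?_⟩
  rintro _ ⟨w, hw, rfl⟩
  exact Real.sqrt_le_sqrt (integral_mono (hL2 w hw).integrable_sq
    ((hL2 w₀ hw₀).add (memLp_const _)).integrable_sq fun z =>
      pow_le_pow_left₀ (hnonneg w hw z) (loss_le_add hWbdd hWU hlip hw hw₀ z) 2)

theorem bddAbove_valueAtRisk (hWbdd : Bornology.IsBounded W) (hWU : W ⊆ U)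
    (hmeas : Measurable fun p : Par d × S => loss p.1 p.2)
    (hlip : ∀ z, LipschitzOnWith lamL (fun w => loss w z) U) {w₀ : Par d} (hw₀ : w₀ ∈ W) {a : ℝ}
    (ha : 0 < a) (ha1 : a < 1) : BddAbove ((fun w => valueAtRisk P a (loss w)) '' W) := by
  have hXm : ∀ w, Measurable (loss w) := fun w => hmeas.comp measurable_prodMk_left
  refine ⟨valueAtRisk P a (loss w₀) + lamL * Metric.diam W, ?_⟩
  rintro _ ⟨w, hw, rfl⟩
  refine (valueAtRisk_le_iff (hXm w) ha ha1).2
    (((valueAtRisk_le_iff (hXm w₀) ha ha1).1 le_rfl).trans (measureReal_mono fun z hz => ?_))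
  have h1 := loss_le_add hWbdd hWU hlip hw hw₀ z
  have h2 : loss w₀ z ≤ valueAtRisk P a (loss w₀) := hz
  simp only [Set.mem_ofPred_eq]
  linarith

/-! ### Measurable dependence on the parameter -/

theorem measurable_valueAtRisk (hmeas : Measurable fun p : Par d × S => loss p.1 p.2) {a : ℝ}
    (ha : 0 < a) (ha1 : a < 1) : Measurable fun w => valueAtRisk P a (loss w) := by
  refine measurable_of_Iic fun u => ?_
  have h1 : Measurable fun w => distFun P (loss w) u :=
    (measurable_measure_prodMk_left (ν := P)
      (measurableSet_le hmeas (measurable_const (a := u)))).ennreal_toReal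
  have h2 : (fun w => valueAtRisk P a (loss w)) ⁻¹' Set.Iic u =
      {w | 1 - a ≤ distFun P (loss w) u} := by
    ext w
    exact valueAtRisk_le_iff (hmeas.comp measurable_prodMk_left) ha ha1
  rw [h2]
  exact measurableSet_le measurable_const h1

theorem measurable_cvar (hmeas : Measurable fun p : Par d × S => loss p.1 p.2) (hα : 0 < α)
    (hα1 : α < 1) : Measurable fun w => cvar P α (loss w) := by
  have h1 : Measurable fun p : Par d × S => truncBelow (loss p.1) (valueAtRisk P α (loss p.1)) p.2 :=
    Measurable.ite (measurableSet_le ((measurable_valueAtRisk hmeas hα hα1).comp measurable_fst)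
      hmeas) hmeas measurable_const
  have h2 : (fun w => cvar P α (loss w)) =
      fun w => 1 / α * ∫ z, truncBelow (loss w) (valueAtRisk P α (loss w)) z ∂P := by
    funext w
    rw [integral_truncBelow (X := loss w) (hmeas.comp measurable_prodMk_left)]
    rfl
  rw [h2]
  exact (StronglyMeasurable.integral_prod_right' (f := fun p : Par d × S =>
    truncBelow (loss p.1) (valueAtRisk P α (loss p.1)) p.2)
    h1.stronglyMeasurable).measurable.const_mul _

theorem measurable_validate {S : Type*} [MeasurableSpace S] {loss : Par d → S → ℝ}
    (hmeas : Measurable fun p : Par d × S => loss p.1 p.2) {n : ℕ}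
    {R : (Fin (n / 2) → ℝ) → ℝ} (hR : Measurable R) (α : ℝ) :
    Measurable fun p : Par d × (Fin n → S) => validate R α (loss p.1) p.2 := by
  have h : ∀ i, Measurable fun p : Par d × (Fin n → S) => loss p.1 (p.2 i) := fun i =>
    hmeas.comp (measurable_fst.prodMk ((measurable_pi_apply i).comp measurable_snd))
  exact (measurable_scaledCVaREst hR α).comp
    ((measurable_pi_lambda _ fun i => h _).prodMk (measurable_pi_lambda _ fun i => h _))

end Uniform

end CVaRLearning

open MeasureTheory CVaRLearning
theorem theorem2 {S : Type*} [MeasurableSpace S] (P : Measure S) [IsProbabilityMeasure P]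
    {d n : ℕ} (W U : Set (Par d)) (loss : Par d → S → ℝ)
    (α δ γ lam : ℝ) (lamL : NNReal)
    (hα : 0 < α) (hα' : α < 1 / 2) (hδ : 0 < δ) (hδ' : δ < 1)
    (hγ : 0 < γ) (hγlam : γ < lam)
    -- the domain
    (hWclosed : IsClosed W) (hWconv : Convex ℝ W) (hWbdd : Bornology.IsBounded W)
    (hWdiam : 0 < Metric.diam W)
    -- the loss: convex and Lipschitz on an open set around the domain
    (hU : IsOpen U) (hWU : W ⊆ U)
    (hmeas : Measurable fun p : Par d × S => loss p.1 p.2)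
    (hconv : ∀ z, ConvexOn ℝ U fun w => loss w z)
    (hlip : ∀ z, LipschitzOnWith lamL (fun w => loss w z) U)
    (hnonneg : ∀ w ∈ W, ∀ z, 0 ≤ loss w z)
    -- the distribution of the loss
    (hL2 : ∀ w ∈ W, MemLp (loss w) 2 P)
    (hcont : ∀ w ∈ W, Continuous (distFun P (loss w)))
    (hgrowth : ∀ w ∈ W, LocalGrowth P α γ lam (loss w))
    (hσ : BddAbove ((fun w => tailStd P α (loss w)) '' W))
    (hV : BddAbove ((fun w => valueAtRisk P α (loss w)) '' W))
    -- the uniform constants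
    (σbar rbar Vbar Vbar' Δ : ℝ)
    (hσbar : σbar = supOver W loss (tailStd P α))
    (hrbar : rbar = supOver W loss (rootMeanSq P))
    (hVbar : Vbar = supOver W loss (valueAtRisk P α))
    (hVbar' : Vbar' = supOver W loss (valueAtRisk P (α / 2)))
    (hΔ : Δ = Metric.diam W)
    -- the size of the samples
    (hn : (1 + Real.log (5 / subLevel δ)) * max (1 / (2 * γ ^ 2)) (16 / (3 * α)) ≤ (n / 2 : ℕ))
    -- the robust mean estimation sub-routine
    (R : (Fin (n / 2) → ℝ) → ℝ) (hR : Measurable R) (c s : ℝ)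
    (hRc : RobustMean (subLevel δ / 5) σbar rbar R c s)
    -- the sub-processes: initial value, update direction, data, step sizes
    (x₀ : Joint d) (hx₀ : x₀ ∈ feasible W Vbar)
    (G : Joint d → S → Joint d) (hGmeas : Measurable fun p : Joint d × S => G p.1 p.2)
    (hG : ∀ x ∈ feasible W Vbar, ∀ z,
      IsSubgradient {y | y.fst ∈ U} (objective α loss z) x (G x z))
    (I : Fin (numParts δ) → Finset (Fin n)) (hI : IsBalancedPartition I)
    (β : Fin (numParts δ) → ℝ)
    (hβ : ∀ j, β j = α * √((Δ ^ 2 + Vbar ^ 2) / (((lamL : ℝ) ^ 2 + (1 - α) ^ 2) * (I j).card))) :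
    1 - 3 * δ ≤
      ((Measure.pi fun _ : Fin n => P).prod (Measure.pi fun _ : Fin n => P)).real
        {ω | ∀ w, IsOutput R α loss (feasible W Vbar) G x₀ I β ω.1 ω.2 w →
          w ∈ W ∧
          cvar P α (loss w) - infOver W loss (cvar P α) ≤
            2 / α * (c * s + Vbar' * lam / (√2 * γ)) *
                √((1 + Real.log (5 / subLevel δ)) / (n / 2 : ℕ))
              + Real.exp 1 / α *
                √(((lamL : ℝ) ^ 2 + (1 - α) ^ 2) * (Δ ^ 2 + Vbar ^ 2) / (n / numParts δ : ℕ))} := by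
  have hδs := subLevel_pos hδ hδ'
  have hδs1 : subLevel δ ≤ δ := subLevel_le hδ hδ'
  have hη : 0 < subLevel δ / 5 := by positivity
  have hη1 : subLevel δ / 5 < 1 := by linarith
  have hlog : Real.log (1 / (subLevel δ / 5)) = Real.log (5 / subLevel δ) := by
    rw [one_div_div]
  have hkL := numParts_lt hδ hδ'
  set L := Real.log (5 / subLevel δ) with hL
  have hLpos : 0 < L := Real.log_pos (by rw [lt_div_iff₀ hδs]; linarith)
  have hm2 : (1 + L) * (16 / (3 * α)) ≤ (n / 2 : ℕ) :=
    (mul_le_mul_of_nonneg_left (le_max_right _ _) (by linarith)).trans hn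
  have hm8 : 8 * (1 + L) ≤ (n / 2 : ℕ) := by
    have : 8 ≤ 16 / (3 * α) := by rw [le_div_iff₀ (by positivity)]; linarith
    nlinarith
  have hα1 : α < 1 := by linarith
  have hx₀W : x₀.fst ∈ W := hx₀.1
  have hXm : ∀ w, Measurable (loss w) := fun w => hmeas.comp measurable_prodMk_left
  -- the uniform constants dominate those of the single losses
  have hσle : ∀ w ∈ W, tailStd P α (loss w) ≤ σbar := fun w hw =>
    hσbar ▸ le_csSup hσ ⟨w, hw, rfl⟩
  have hrle : ∀ w ∈ W, rootMeanSq P (loss w) ≤ rbar := fun w hw =>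
    hrbar ▸ le_csSup (bddAbove_rootMeanSq hWbdd hWU hlip hnonneg hL2 hx₀W) ⟨w, hw, rfl⟩
  have hVle : ∀ w ∈ W, valueAtRisk P α (loss w) ≤ Vbar := fun w hw =>
    hVbar ▸ le_csSup hV ⟨w, hw, rfl⟩
  have hV'le : ∀ w ∈ W, valueAtRisk P (α / 2) (loss w) ≤ Vbar' := fun w hw =>
    hVbar' ▸ le_csSup (bddAbove_valueAtRisk hWbdd hWU hmeas hlip hx₀W (by linarith) (by linarith))
      ⟨w, hw, rfl⟩
  have hstd := tailStd_pos (hXm _) (hnonneg _ hx₀W) (hL2 _ hx₀W) (hcont _ hx₀W) hα hα'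
  have hσ0 : 0 < σbar := hstd.trans_le (hσle _ hx₀W)
  have hr0 : 0 < rbar :=
    (hstd.trans_le (tailStd_le_rootMeanSq (hL2 _ hx₀W))).trans_le (hrle _ hx₀W)
  have hguar := hRc.meanGuarantee hη hη1 hσ0 hr0 (by rw [hlog]; exact hm8)
  -- every block of the training sample is nonempty
  have hkpos : 0 < numParts δ := by
    rw [Nat.pos_iff_ne_zero]
    intro h0
    have h1 := exp_neg_numParts_le hδ hδ'
    rw [h0] at h1
    simp at h1
    linarith
  have hkn : numParts δ ≤ n := by
    have h1 : (numParts δ : ℝ) ≤ (n / 2 : ℕ) := by linarith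
    have h2 : numParts δ ≤ n / 2 := by exact_mod_cast h1
    omega
  have hnk : 1 ≤ n / numParts δ := (Nat.one_le_div_iff hkpos).2 hkn
  have hcard : ∀ j, 0 < (I j).card := fun j => lt_of_lt_of_le hnk (hI.2.2 j)
  set K := feasible W Vbar with hK
  have hKcl : IsClosed K := isClosed_feasible hWclosed Vbar
  have hKc : Convex ℝ K := convex_feasible hWconv Vbar
  set C := infOver W loss (cvar P α) with hC
  set A : ℝ := ((lamL : ℝ) ^ 2 + (1 - α) ^ 2) * (Δ ^ 2 + Vbar ^ 2) with hA
  have hA0 : 0 ≤ A := by positivity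
  let avg : Fin (numParts δ) → (Fin n → S) → Joint d := fun j z =>
    sgdAverage K G (β j) x₀ fun t : Fin (I j).card => z ((I j).orderEmbOfFin rfl t)
  have hcand : ∀ j z, candidate K G (β j) x₀ (I j) z = (avg j z).fst := fun _ _ => rfl
  have havg : ∀ j z, avg j z ∈ K := fun j z => sgdAverage_mem hKcl hKc hx₀ (hcard j) _
  have hmp := fun j => measurePreserving_comp_injective (ι := Fin n) P
    ((I j).orderEmbOfFin rfl).injective
  have havgm : ∀ j, Measurable (avg j) := fun j =>
    (measurable_sgdAverage (N := (I j).card) (β := β j) hKcl hKc ⟨x₀, hx₀⟩ hGmeas).comp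
      (hmp j).measurable
  -- all candidates are poor
  let A₁ : Fin (numParts δ) → Set (Fin n → S) := fun j => {z | Real.exp 1 / α * √(A / (I j).card) ≤
    expObjective P α loss (avg j z) - C}
  have hA₁m : ∀ j, MeasurableSet (A₁ j) := fun j =>
    measurableSet_le measurable_const
      (((measurable_expObjective hmeas).comp (havgm j)).sub_const C)
  have hA₁d : ∀ j, DependsOn (· ∈ A₁ j) (I j : Set (Fin n)) := by
    intro j z z' hz
    have : avg j z = avg j z' := by
      simp only [avg]
      congr 1
      funext t
      exact hz _ ((I j).orderEmbOfFin_mem rfl t)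
    simp only [A₁, Set.mem_ofPred_eq, this]
  have hA₁le : ∀ j, (Measure.pi fun _ : Fin n => P) (A₁ j) ≤ ENNReal.ofReal (Real.exp (-1)) := by
    intro j
    have h := pi_excess_sgdAverage_le (P := P) hα hα' hWclosed hWconv hWbdd hWdiam hU hWU hmeas
      hlip hnonneg hL2 hcont hVle hx₀ hGmeas hG (hcard j) (β := β j) (by rw [hβ j, hΔ])
    rw [← hΔ, ← (hmp j).map_eq] at h
    exact (Measure.le_map_apply (hmp j).measurable.aemeasurable _).trans h
  have hbad₁ : (Measure.pi fun _ : Fin n => P) (⋂ j ∈ (Finset.univ : Finset (Fin (numParts δ))), A₁ j) ≤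
      ENNReal.ofReal δ := by
    rw [pi_biInter_eq_prod P I hI.1 hA₁m hA₁d]
    refine (Finset.prod_le_prod' fun j _ => hA₁le j).trans ?_
    rw [Finset.prod_const, Finset.card_univ, Fintype.card_fin,
      ← ENNReal.ofReal_pow (Real.exp_pos _).le, ← Real.exp_nat_mul, mul_neg_one]
    exact ENNReal.ofReal_le_ofReal ((exp_neg_numParts_le hδ hδ').trans hδs1)
  -- the validation score of some candidate is inaccurate
  set ε := (c * s + Vbar' * lam / (√2 * γ)) * √((1 + L) / (n / 2 : ℕ)) with hε
  let A₂ : Fin (numParts δ) → Set ((Fin n → S) × (Fin n → S)) := fun j => {p | ε <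
    |validate R α (loss (avg j p.1).fst) p.2 - α * cvar P α (loss (avg j p.1).fst)|}
  have hA₂m : ∀ j, MeasurableSet (A₂ j) := by
    intro j
    have h1 : Measurable fun p : (Fin n → S) × (Fin n → S) => (avg j p.1).fst :=
      continuous_joint_fst.measurable.comp ((havgm j).comp measurable_fst)
    refine measurableSet_lt measurable_const (Measurable.abs (Measurable.sub ?_ ?_))
    · exact (measurable_validate hmeas hR α).comp (h1.prodMk measurable_snd)
    · exact ((measurable_cvar hmeas hα hα1).comp h1).const_mul α
  have hA₂le : ∀ j, ((Measure.pi fun _ : Fin n => P).prod (Measure.pi fun _ : Fin n => P)) (A₂ j) ≤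
      ENNReal.ofReal (subLevel δ) := by
    intro j
    rw [Measure.prod_apply (hA₂m j)]
    refine (lintegral_mono (g := fun _ => ENNReal.ofReal (subLevel δ)) fun z => ?_).trans (by simp)
    have hw := (havg j z).1
    have h := pi_lt_abs_validate_sub_le (P := P) (hXm _) (hnonneg _ hw) (hL2 _ hw) (hcont _ hw) hα
      hα' hγ (hγ.trans hγlam) (hgrowth _ hw) (hV'le _ hw) (c := c) (s := s) hη hη1
      (by rw [hlog]; exact hn) hR (by
        rcases hguar with ⟨h1, h2⟩ | ⟨h1, h2⟩
        · exact Or.inl ⟨h2, h1 ▸ hσle _ hw⟩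
        · exact Or.inr ⟨h2, h1 ▸ hrle _ hw⟩)
    rw [hlog] at h
    refine h.trans_eq ?_
    rw [show (5 : ENNReal) = ENNReal.ofReal 5 by simp, ← ENNReal.ofReal_mul (by norm_num)]
    congr 1
    ring
  set μ := (Measure.pi fun _ : Fin n => P).prod (Measure.pi fun _ : Fin n => P) with hμ
  set Bad : Set ((Fin n → S) × (Fin n → S)) :=
    (⋂ j ∈ (Finset.univ : Finset (Fin (numParts δ))), A₁ j) ×ˢ Set.univ ∪
      ⋃ j ∈ (Finset.univ : Finset (Fin (numParts δ))), A₂ j with hBad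
  have hBadle : μ.real Bad ≤ 2 * δ := by
    have h1 : μ Bad ≤ ENNReal.ofReal (2 * δ) := by
      refine (measure_union_le _ _).trans ?_
      rw [two_mul, ENNReal.ofReal_add hδ.le hδ.le]
      refine add_le_add ?_ ?_
      · rw [hμ, Measure.prod_prod, measure_univ, mul_one]
        exact hbad₁
      · refine (measure_biUnion_finset_le _ _).trans
          ((Finset.sum_le_sum fun j _ => hA₂le j).trans ?_)
        rw [Finset.sum_const, Finset.card_univ, Fintype.card_fin, nsmul_eq_mul,
          ← ENNReal.ofReal_natCast, ← ENNReal.ofReal_mul (Nat.cast_nonneg _)]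
        exact ENNReal.ofReal_le_ofReal (numParts_mul_subLevel_le hδ hδ')
    exact ENNReal.toReal_le_of_le_ofReal (by linarith) h1
  have hcover : ∀ T : Set ((Fin n → S) × (Fin n → S)), Badᶜ ⊆ T → 1 - 3 * δ ≤ μ.real T := by
    intro T hT
    have h1 : (1 : ℝ) ≤ μ.real T + μ.real Bad := by
      have h2 : (Set.univ : Set ((Fin n → S) × (Fin n → S))) ⊆ T ∪ Bad := fun ω _ => by
        by_cases h : ω ∈ Bad
        · exact Or.inr h
        · exact Or.inl (hT h)
      rw [← probReal_univ (μ := μ)]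
      exact (measureReal_mono h2).trans (measureReal_union_le _ _)
    linarith
  refine hcover _ fun ω hω w hw => ?_
  obtain ⟨j, rfl, hmin⟩ := hw
  rw [hBad, Set.mem_compl_iff, Set.mem_union, not_or] at hω
  obtain ⟨hω1, hω2⟩ := hω
  have hval : ∀ i, |validate R α (loss (avg i ω.1).fst) ω.2 -
      α * cvar P α (loss (avg i ω.1).fst)| ≤ ε := fun i => by
    by_contra! h
    exact hω2 (Set.mem_biUnion (Finset.mem_coe.2 (Finset.mem_univ i)) h)
  obtain ⟨i, hi⟩ : ∃ i, ω.1 ∉ A₁ i := by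
    by_contra! h
    exact hω1 ⟨Set.mem_iInter₂.2 fun i _ => h i, Set.mem_univ _⟩
  refine ⟨(havg j ω.1).1, ?_⟩
  have h1 := abs_le.1 (hval j)
  have h2 := abs_le.1 (hval i)
  have h3 := hmin i
  rw [hcand, hcand] at h3
  rw [hcand]
  have h4 : expObjective P α loss (avg i ω.1) - C < Real.exp 1 / α * √(A / (I i).card) :=
    not_le.1 hi
  have h5 := (cvar_le_expObjective (P := P) (x := avg i ω.1) hα hα1 (hXm _)
    ((hL2 _ (havg i ω.1).1).integrable (by norm_num)) (hcont _ (havg i ω.1).1)).1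
  have h6 : Real.exp 1 / α * √(A / (I i).card) ≤ Real.exp 1 / α * √(A / (n / numParts δ : ℕ)) := by
    have h7 : (0 : ℝ) < (n / numParts δ : ℕ) := by exact_mod_cast hnk
    have h8 : ((n / numParts δ : ℕ) : ℝ) ≤ (I i).card := by exact_mod_cast hI.2.2 i
    gcongr
  have h9 : cvar P α (loss (avg j ω.1).fst) - cvar P α (loss (avg i ω.1).fst) ≤ 2 / α * ε := by
    rw [div_mul_eq_mul_div, le_div_iff₀ hα]
    linarith
  rw [mul_assoc (2 / α), ← hε]
  linarith
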